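/- Let $0<q<1$, $\mathbb{R}_q^+=\{q^n : n\in\mathbb{Z}\}$, and $\int_0^\infty g(x)\,d_qx=(1-q)\sum_{n\in\mathbb{Z}}q^n g(q^n)$. Let $L^2(\mathbb{R}_q^+)$ be the space of $g:\mathbb{R}_q^+\to\mathbb{C}$ with $\int_0^\infty|g(x)|^2d_qx<\infty$. Put $$\Delta_q g(x)=\frac1{x^2}\Big[g(q^{-1}x)-\frac{1+q}{q}g(x)+\frac1q g(qx)\Big],\qquad D_qg(x)=\frac{g(x)-g(qx)}{(1-q)x},\qquad \Lambda_q^{-1}g(x)=g(q^{-1}x),$$ $$W_x(F,G)=\frac{(1-q)^2}{q}\big[F(x)\,\Lambda_q^{-1}D_qG(x)-G(x)\,\Lambda_q^{-1}D_qF(x)\big],$$ and let $Lg=v g-\Delta_q g$, where $v:\mathbb{R}_q^+\to\mathbb{R}$ is a given potential. Values and derivatives at $0$ are limits along $\mathbb{R}_q^+$: $g(0)=\lim_{n\to\infty}g(q^n)$, $g'(0)=\lim_{n\to\infty}(g(q^n)-g(0))/q^n$. Fix $\alpha\in\mathbb{R}$ and, for every $\lambda\in\mathbb{C}$, let $\phi(\cdot,\lambda)$,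 $\theta(\cdot,\lambda)$ be solutions of $\Delta_qg+(\lambda-v)g=0$ on $\mathbb{R}_q^+$ with $$\phi(0)=\tfrac{\sqrt q}{1-q}\sin\alpha,\quad \phi'(0)=-\tfrac{\sqrt q}{1-q}\cos\alpha,\quad \theta(0)=\tfrac{\sqrt q}{1-q}\cos\alpha,\quad \theta'(0)=\tfrac{\sqrt q}{1-q}\sin\alpha .$$ For $b\in\mathbb{R}_q^+$ and non-real $\lambda$ let $C_b(\lambda)$ be the Weyl circle of all $l\in\mathbb{C}$ such that $(\theta+l\phi)(b)\cos\beta+\Lambda_q^{-1}D_q(\theta+l\phi)(b)\sin\beta=0$ for some $\beta\in\mathbb{R}$. Let $m$ be a function such that, for every non-real $\lambda$, $m(\lambda)$ is the limit point of the circles $C_b(\lambda)$ as $b\to\infty$, or a point of their limit circle; assume that $m$ is a single analytic function on the plane whose only singularities are poles on the real axis. Denote these poles, listed without repetition, by $\lambda_n$, and the residues of $m$ at them by $r_n$ (the poles are simple). Put $\psi(x,\lambda)=\theta(x,\lambda)+m(\lambda)\phi(x,\lambda)$ and $\psi_n(x)=\sqrt{r_n}\,\phi(x,\lambda_n)$.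 Let $\mathcal{L}_{q,2}$ be the space of all $f\in L^2(\mathbb{R}_q^+)$ such that $Lf\in L^2(\mathbb{R}_q^+)$; $f(0)$ and $f'(0)$ exist and $f(0)\cos\alpha+f'(0)\sin\alpha=0$; and $\lim_{x\to\infty,\,x\in\mathbb{R}_q^+}W_x(\psi(\cdot,\lambda),f)=0$ for every non-real $\lambda$. Then for every $f\in\mathcal{L}_{q,2}$ the $q$-integrals $c_n=\int_0^\infty\psi_n(y)f(y)\,d_qy$ converge absolutely and $$\int_0^\infty f(x)^2\,d_qx=\sum_n c_n^2 ,$$ where the series converges unconditionally. -/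

import Mathlib

open Filter Topology

noncomputable section

namespace QSturm

/-- The grid `ℝ_q^+ = {q ^ n : n ∈ ℤ}`. A function on the grid is represented by a function
`ℝ → ℂ`; every notion below only reads its values at points of the grid. -/
def grid (q : ℝ) : Set ℝ := Set.range fun n : ℤ => q ^ n

/-- The `q`-derivative `D_q f (x) = (f x - f (q x)) / ((1 - q) x)` at a point `x ≠ 0`. -/
def qDeriv (q : ℝ) (f : ℝ → ℂ) (x : ℝ) : ℂ :=
  (f x - f (q * x)) / (((1 - q) * x : ℝ) : ℂ)

/-- `Λ_q⁻¹ D_q f (x) = D_q f (q⁻¹ x)`. -/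
def shiftQDeriv (q : ℝ) (f : ℝ → ℂ) (x : ℝ) : ℂ := qDeriv q f (q⁻¹ * x)

/-- The `q`-Laplace operator
`Δ_q f (x) = x⁻² (f (q⁻¹ x) - ((1 + q) / q) f x + (1 / q) f (q x))`. -/
def qLaplacian (q : ℝ) (f : ℝ → ℂ) (x : ℝ) : ℂ :=
  (f (q⁻¹ * x) - (((1 + q) / q : ℝ) : ℂ) * f x + ((1 / q : ℝ) : ℂ) * f (q * x)) /
    ((x ^ 2 : ℝ) : ℂ)

/-- The `q`-Schrödinger operator `L = v - Δ_q` with real potential `v`. -/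
def schrodinger (q : ℝ) (v : ℝ → ℝ) (f : ℝ → ℂ) (x : ℝ) : ℂ :=
  (v x : ℂ) * f x - qLaplacian q f x

/-- `f` solves `Δ_q f + (z - v) f = 0` on the grid. -/
def IsSolution (q : ℝ) (v : ℝ → ℝ) (z : ℂ) (f : ℝ → ℂ) : Prop :=
  ∀ x ∈ grid q, qLaplacian q f x + (z - (v x : ℂ)) * f x = 0

/-- Values at the endpoint `0`: `f 0 = a` and `f' 0 = b`, as limits along the grid. -/
def HasValuesAtZero (q : ℝ) (f : ℝ → ℂ) (a b : ℂ) : Prop :=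
  Tendsto (fun n : ℕ => f (q ^ n)) atTop (𝓝 a) ∧
    Tendsto (fun n : ℕ => (f (q ^ n) - a) / ((q ^ n : ℝ) : ℂ)) atTop (𝓝 b)

/-- Absolute convergence of the Jackson integral over `[0, ∞)`. -/
def QIntegrable (q : ℝ) (f : ℝ → ℂ) : Prop :=
  Summable fun n : ℤ => ((q ^ n : ℝ) : ℂ) * f (q ^ n)

/-- Jackson's `q`-integral `∫₀^∞ f d_q x = (1 - q) ∑_{n ∈ ℤ} q ^ n f (q ^ n)`. -/
def qIntegral (q : ℝ) (f : ℝ → ℂ) : ℂ :=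
  ((1 - q : ℝ) : ℂ) * ∑' n : ℤ, ((q ^ n : ℝ) : ℂ) * f (q ^ n)

/-- Membership in `L²(ℝ_q^+)`: the Jackson integral of `|f|²` is finite. -/
def MemL2 (q : ℝ) (f : ℝ → ℂ) : Prop :=
  Summable fun n : ℤ => q ^ n * ‖f (q ^ n)‖ ^ 2

/-- The `q`-Wronskian
`W_x(F, G) = ((1 - q)² / q) (F x · Λ_q⁻¹ D_q G x - G x · Λ_q⁻¹ D_q F x)`. -/
def wronskian (q : ℝ) (F G : ℝ → ℂ) (x : ℝ) : ℂ :=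
  (((1 - q) ^ 2 / q : ℝ) : ℂ) * (F x * shiftQDeriv q G x - G x * shiftQDeriv q F x)

/-- The family `φ(·, z)`, `z ∈ ℂ`: solutions with `φ(0) = (√q / (1 - q)) sin α`,
`φ'(0) = -(√q / (1 - q)) cos α`. -/
def IsPhi (q : ℝ) (v : ℝ → ℝ) (α : ℝ) (φ : ℂ → ℝ → ℂ) : Prop :=
  ∀ z : ℂ, IsSolution q v z (φ z) ∧
    HasValuesAtZero q (φ z)
      ((√q / (1 - q) * Real.sin α : ℝ) : ℂ) ((-(√q / (1 - q)) * Real.cos α : ℝ) : ℂ)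

/-- The family `θ(·, z)`, `z ∈ ℂ`: solutions with `θ(0) = (√q / (1 - q)) cos α`,
`θ'(0) = (√q / (1 - q)) sin α`. -/
def IsTheta (q : ℝ) (v : ℝ → ℝ) (α : ℝ) (θ : ℂ → ℝ → ℂ) : Prop :=
  ∀ z : ℂ, IsSolution q v z (θ z) ∧
    HasValuesAtZero q (θ z)
      ((√q / (1 - q) * Real.cos α : ℝ) : ℂ) ((√q / (1 - q) * Real.sin α : ℝ) : ℂ)

/-- Weyl's circle `C_b`: the numbers `l` such that `θ + l φ` satisfies, for some real `β`, the
boundary condition `(θ + l φ)(b) cos β + Λ_q⁻¹ D_q (θ + l φ)(b) sin β = 0`. -/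
def weylCircle (q : ℝ) (θ φ : ℝ → ℂ) (b : ℝ) : Set ℂ :=
  {l | ∃ β : ℝ, (θ b + l * φ b) * (Real.cos β : ℂ) +
    (shiftQDeriv q θ b + l * shiftQDeriv q φ b) * (Real.sin β : ℂ) = 0}

/-- `c` is the limit point, or lies on the limit circle, of the circles `C_b` as `b → ∞` along
the grid: it is a limit of points `l_b ∈ C_b`. -/
def IsWeylLimit (q : ℝ) (θ φ : ℝ → ℂ) (c : ℂ) : Prop :=
  ∃ l : ℕ → ℂ, (∀ n : ℕ, l n ∈ weylCircle q θ φ (q ^ (-(n : ℤ)))) ∧ Tendsto l atTop (𝓝 c)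

/-- `ψ(x, z) = θ(x, z) + m(z) φ(x, z)`. -/
def psi (θ φ : ℂ → ℝ → ℂ) (m : ℂ → ℂ) (z : ℂ) (x : ℝ) : ℂ := θ z x + m z * φ z x

/-- `m` is a Weyl function: for non-real `z`, `m z` is the limit point or lies on the limit
circle, and `m` is one analytic function in the plane whose only singularities are poles
on the real axis. -/
structure IsWeylFunction (q : ℝ) (θ φ : ℂ → ℝ → ℂ) (m : ℂ → ℂ) : Prop where
  isWeylLimit : ∀ z : ℂ, z.im ≠ 0 → IsWeylLimit q (θ z) (φ z) (m z)
  analyticAt : ∀ z : ℂ, z.im ≠ 0 → AnalyticAt ℂ m z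
  meromorphicAt : ∀ z : ℂ, MeromorphicAt m z

/-- The set of poles of `m`. -/
def poles (m : ℂ → ℂ) : Set ℂ := {z | meromorphicOrderAt m z < 0}

/-- The residue `lim_{w → z} (w - z) m(w)` at a simple pole `z`
(all poles of a Weyl function are simple). -/
def simplePoleResidue (m : ℂ → ℂ) (z : ℂ) : ℂ := limUnder (𝓝[≠] z) fun w => (w - z) * m w

/-- The eigenfunction `√r φ(x, z)`, `r` the residue of `m` at `z`. -/
def eigenfunction (φ : ℂ → ℝ → ℂ) (m : ℂ → ℂ) (z : ℂ) (x : ℝ) : ℂ :=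
  Complex.sqrt (simplePoleResidue m z) * φ z x

/-- The Fourier coefficient `∫₀^∞ √r φ(y, z) f(y) d_q y`. -/
def qFourierCoeff (q : ℝ) (φ : ℂ → ℝ → ℂ) (m : ℂ → ℂ) (f : ℝ → ℂ) (z : ℂ) : ℂ :=
  qIntegral q fun y => eigenfunction φ m z y * f y

/-- The class `𝓛_{q,2}`. -/
structure MemClass (q : ℝ) (v : ℝ → ℝ) (α : ℝ) (θ φ : ℂ → ℝ → ℂ) (m : ℂ → ℂ)
    (f : ℝ → ℂ) : Prop where
  memL2 : MemL2 q f
  memL2_schrodinger : MemL2 q (schrodinger q v f)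
  boundary : ∃ a b : ℂ, HasValuesAtZero q f a b ∧
    a * (Real.cos α : ℂ) + b * (Real.sin α : ℂ) = 0
  wronskian_tendsto : ∀ z : ℂ, z.im ≠ 0 →
    Tendsto (fun n : ℕ => wronskian q (psi θ φ m z) f (q ^ (-(n : ℤ)))) atTop (𝓝 0)

end QSturm

end

open QSturm

/-!
Parseval's identity holds because the Green function of the `q`-Sturm-Liouville problem is a
meromorphic function of the spectral parameter which decays like a resolvent.

In terms of the sequences `n ↦ g (q ^ n)` the equation is a three-term recurrence and the Jackson
integral a weighted sum over `ℤ`, with weights `w`. For `x ≤ y` the Green function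
`φ(x, z) ψ(y, z)`, with `ψ = θ + m φ`, is meromorphic in `z`: `m` is so by assumption, and `φ`,
`θ` are entire because solutions with prescribed values at `0` satisfy a variation of parameters
formula around every `z` (`IsFundamental.differentiable`). Its poles are those of `m`, with
residues `r φ(x) φ(y)`.

The Lagrange identity shows that `Im z` times the energy flux `W(F, conj F) / 2i` of a solution
is monotone along the grid. This flux vanishes at `0` for `φ`, and at `b` for `θ + l φ` with `l`
on the Weyl circle `C_b`; so in the limit `b → ∞` it has a definite sign for `ψ`, whether `m(z)`
is a limit point or a point on a limit circle. Since `W(φ, ψ) = 1`, this yields the resolvent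
bound `|φ(x, z) ψ(y, z)| ≤ C / |Im z|` (`IsWeylSystem.exists_norm_green_le`), and the difference
equation improves it to `|z φ(x, z) ψ(y, z) - δ(x, y) / w(y)| ≤ C / |Im z|`. The same facts show
that the poles of `m` are simple and have non-negative residues.

Integration of `(1 - z² / R²) φ(x, z) ψ(y, z)` over `|z| = R`, where the kernel absorbs the factor
`1 / |Im z|`, gives
`∑_{|λ_n| < R} (1 - λ_n² / R²) r_n φ(x, λ_n) φ(y, λ_n) → δ(x, y) / w(y)` as `R → ∞`
(`tendsto_riesz_mean_residues`). For finitely supported `f` this is Parseval's identity, as the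
means of a series with non-negative terms increase to its sum; it extends to `L²` by Bessel's
inequality (`IsRieszResolution.hasSum_sq`), and to the bilinear form `∫ f²` of complex `f` by
polarisation.
-/

namespace QSturm

/-! ### The difference equation on the grid -/

/-- The weight `(1 - q) q ^ n` of the point `q ^ n` in Jackson's integral. -/
noncomputable def weight (q : ℝ) (n : ℤ) : ℝ := (1 - q) * q ^ n

/-- The equation `Δ_q g + (z - v) g = 0` for the sequence `F n = g (q ^ n)`, as a three-term
recurrence. -/
def IsSeqSolution (q : ℝ) (v : ℤ → ℝ) (z : ℂ) (F : ℤ → ℂ) : Prop :=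
  ∀ n : ℤ, F (n + 1) =
    (1 + q) * F n - q * F (n - 1) - q * ((q : ℂ) ^ n) ^ 2 * (z - v n) * F n

/-- The boundary values at `0` of the sequence `F n = g (q ^ n)`. -/
def SeqValuesAtZero (q : ℝ) (F : ℤ → ℂ) (a b : ℂ) : Prop :=
  Tendsto (fun n : ℕ => F n) atTop (𝓝 a) ∧
    Tendsto (fun n : ℕ => (F n - a) / (q : ℂ) ^ n) atTop (𝓝 b)

/-- The `q`-Wronskian at the point `q ^ n`, in terms of the values at `q ^ n` and
`q ^ (n - 1)`. -/
noncomputable def seqWronskian (q : ℝ) (F G : ℤ → ℂ) (n : ℤ) : ℂ :=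
  (1 - q) * ((q : ℂ) ^ n)⁻¹ * (F n * G (n - 1) - G n * F (n - 1))

section Wronskian

variable {q : ℝ} {v : ℤ → ℝ}

lemma weight_pos (hq0 : 0 < q) (hq1 : q < 1) (n : ℤ) : 0 < weight q n :=
  mul_pos (sub_pos.2 hq1) (zpow_pos hq0 n)

/-- The Lagrange identity. -/
lemma seqWronskian_succ (hq0 : 0 < q) {z w : ℂ} {F G : ℤ → ℂ} (hF : IsSeqSolution q v z F)
    (hG : IsSeqSolution q v w G) (n : ℤ) :
    seqWronskian q F G (n + 1) = seqWronskian q F G n + (w - z) * weight q n * F n * G n := by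
  have hq : (q : ℂ) ≠ 0 := by exact_mod_cast hq0.ne'
  have hqn : (q : ℂ) ^ n ≠ 0 := zpow_ne_zero _ hq
  simp only [seqWronskian, weight, add_sub_cancel_right, hF n, hG n, zpow_add_one₀ hq]
  push_cast
  field_simp
  ring

lemma seqWronskian_sub_left (F G H : ℤ → ℂ) (n : ℤ) :
    seqWronskian q (fun k => F k - G k) H n = seqWronskian q F H n - seqWronskian q G H n := by
  simp only [seqWronskian]; ring

/-- The Wronskian at `0`, in terms of the boundary values. -/
lemma seqWronskian_tendsto (hq0 : 0 < q) {F G : ℤ → ℂ} {a b a' b' : ℂ}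
    (hF : SeqValuesAtZero q F a b) (hG : SeqValuesAtZero q G a' b') :
    Tendsto (fun n : ℕ => seqWronskian q F G n) atTop
      (𝓝 ((1 - q) ^ 2 / q * (a * b' - a' * b))) := by
  have hq : (q : ℂ) ≠ 0 := by exact_mod_cast hq0.ne'
  -- the difference quotient between neighbouring grid points tends to a multiple of `g'(0)`
  have key : ∀ {H : ℤ → ℂ} {c d : ℂ}, SeqValuesAtZero q H c d →
      Tendsto (fun n : ℕ => (H ((n : ℤ) + 1 - 1) - H ((n : ℤ) + 1)) / (q : ℂ) ^ (n + 1)) atTop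
        (𝓝 (d / q - d)) := by
    intro H c d h
    have h1 := (h.2.div_const (q : ℂ)).sub ((tendsto_add_atTop_iff_nat 1).2 h.2)
    refine h1.congr fun n => ?_
    have : (q : ℂ) ^ n ≠ 0 := pow_ne_zero _ hq
    push_cast
    rw [add_sub_cancel_right, pow_succ]
    field_simp
    ring
  rw [← tendsto_add_atTop_iff_nat 1]
  have h := ((((tendsto_add_atTop_iff_nat 1).2 hF.1).mul (key hG)).sub
    (((tendsto_add_atTop_iff_nat 1).2 hG.1).mul (key hF))).const_mul (1 - (q : ℂ))
  convert h using 2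
  · rename_i n
    have : (q : ℂ) ^ (n + 1) ≠ 0 := pow_ne_zero _ hq
    simp only [seqWronskian]
    push_cast
    rw [← Nat.cast_succ, zpow_natCast, Nat.cast_succ]
    field_simp
    ring
  · field_simp

lemma eq_of_step_of_tendsto {E : Type*} [TopologicalSpace E] [T2Space E] {f : ℤ → E} {L : E}
    (hstep : ∀ n, f (n + 1) = f n) (hlim : Tendsto (fun n : ℕ => f n) atTop (𝓝 L)) (n : ℤ) :
    f n = L := by
  have h1 : ∀ n, f n = f 0 := fun n => by
    induction n using Int.induction_on with
    | zero => rfl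
    | succ n ih => rw [hstep, ih]
    | pred n ih => rw [← ih, ← hstep (-(n : ℤ) - 1), sub_add_cancel]
  rw [h1]
  refine tendsto_nhds_unique ?_ hlim
  simp only [h1]
  exact tendsto_const_nhds

/-- Telescoping from `n` towards the endpoint `0`, which is `n → ∞`. -/
lemma eq_sub_tsum_of_step {f d : ℤ → ℂ} {L : ℂ} (hstep : ∀ n, f (n + 1) = f n + d n)
    (hlim : Tendsto (fun n : ℕ => f n) atTop (𝓝 L)) (n : ℤ)
    (hs : Summable fun k : ℕ => d (n + k)) : f n = L - ∑' k : ℕ, d (n + k) := by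
  have hsum : ∀ N : ℕ, ∑ k ∈ Finset.range N, d (n + k) = f (n + N) - f n := fun N => by
    induction N with
    | zero => simp
    | succ N ih => rw [Finset.sum_range_succ, ih, Nat.cast_succ, ← add_assoc, hstep]; ring
  have h1 : Tendsto (fun N : ℕ => f (n + N)) atTop (𝓝 L) := by
    have hf : Tendsto f atTop (𝓝 L) := by
      rw [← Nat.map_cast_int_atTop]
      exact hlim
    exact hf.comp (tendsto_atTop_add_const_left _ n tendsto_natCast_atTop_atTop)
  have h2 := hs.hasSum.tendsto_sum_nat
  simp only [hsum] at h2
  have := tendsto_nhds_unique h2 (h1.sub_const (f n))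
  rw [this]; ring

/-- Expansion of a sequence in a pair with Wronskian `1`. -/
lemma eq_seqWronskian_mul_sub {F G y : ℤ → ℂ} {n : ℤ} (h : seqWronskian q F G n = 1) :
    y n = seqWronskian q y G n * F n - seqWronskian q y F n * G n := by
  have : seqWronskian q y G n * F n - seqWronskian q y F n * G n
      = y n * seqWronskian q F G n := by
    simp only [seqWronskian]; ring
  rw [this, h, mul_one]

end Wronskian

/-! ### Variation of parameters and analyticity in the spectral parameter -/

section Family

variable {q : ℝ} {v : ℤ → ℝ}

lemma SeqValuesAtZero.exists_norm_le {F : ℤ → ℂ} {a b : ℂ} (hF : SeqValuesAtZero q F a b)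
    (N : ℤ) : ∃ M : ℝ, ∀ k : ℕ, ‖F (N + k)‖ ≤ M := by
  have hf : Tendsto F atTop (𝓝 a) := by
    rw [← Nat.map_cast_int_atTop]
    exact hF.1
  have h : Tendsto (fun k : ℕ => ‖F (N + k)‖) atTop (𝓝 ‖a‖) :=
    (hf.comp (tendsto_atTop_add_const_left _ N tendsto_natCast_atTop_atTop)).norm
  obtain ⟨M, hM⟩ := h.bddAbove_range
  exact ⟨M, fun k => hM ⟨k, rfl⟩⟩

lemma weight_add (hq0 : 0 < q) (N : ℤ) (k : ℕ) : weight q (N + k) = weight q N * q ^ k := by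
  rw [weight, weight, zpow_add₀ hq0.ne', zpow_natCast, mul_assoc]

/-- The Jackson integral of `y G` over the grid points in `(0, q ^ N]`. -/
noncomputable def tailIntegral (q : ℝ) (y G : ℤ → ℂ) (N : ℤ) : ℂ :=
  ∑' k : ℕ, (weight q (N + k) : ℂ) * y (N + k) * G (N + k)

lemma hasSum_weight (hq0 : 0 < q) (hq1 : q < 1) (N : ℤ) (C : ℝ) :
    HasSum (fun k : ℕ => weight q (N + k) * C) (q ^ N * C) := by
  have h := (hasSum_geometric_of_lt_one hq0.le hq1).mul_left (weight q N * C)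
  have h1 : (1 - q) ≠ 0 := (sub_pos.2 hq1).ne'
  have h2 : weight q N * C * (1 - q)⁻¹ = q ^ N * C := by rw [weight]; field_simp
  rw [h2] at h
  simpa only [weight_add hq0, mul_right_comm] using h

lemma norm_tail_term_le (hq0 : 0 < q) (hq1 : q < 1) {y G : ℤ → ℂ} {N : ℤ} {Y M : ℝ}
    (hy : ∀ k : ℕ, ‖y (N + k)‖ ≤ Y) (hG : ∀ k : ℕ, ‖G (N + k)‖ ≤ M) (k : ℕ) :
    ‖(weight q (N + k) : ℂ) * y (N + k) * G (N + k)‖ ≤ weight q (N + k) * (Y * M) := by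
  have hw := weight_pos hq0 hq1 (N + k)
  rw [norm_mul, norm_mul, Complex.norm_real, Real.norm_of_nonneg hw.le, mul_assoc]
  have := mul_le_mul (hy k) (hG k) (norm_nonneg _) ((norm_nonneg _).trans (hy k))
  gcongr

lemma summable_tail (hq0 : 0 < q) (hq1 : q < 1) {y G : ℤ → ℂ} {N : ℤ} {Y M : ℝ}
    (hy : ∀ k : ℕ, ‖y (N + k)‖ ≤ Y) (hG : ∀ k : ℕ, ‖G (N + k)‖ ≤ M) :
    Summable fun k : ℕ => (weight q (N + k) : ℂ) * y (N + k) * G (N + k) :=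
  .of_norm_bounded (hasSum_weight hq0 hq1 N (Y * M)).summable
    (norm_tail_term_le hq0 hq1 hy hG)

lemma norm_tailIntegral_le (hq0 : 0 < q) (hq1 : q < 1) {y G : ℤ → ℂ} {N : ℤ} {Y M : ℝ}
    (hy : ∀ k : ℕ, ‖y (N + k)‖ ≤ Y) (hG : ∀ k : ℕ, ‖G (N + k)‖ ≤ M) :
    ‖tailIntegral q y G N‖ ≤ q ^ N * (Y * M) :=
  tsum_of_norm_bounded (hasSum_weight hq0 hq1 N (Y * M)) (norm_tail_term_le hq0 hq1 hy hG)

/-- Two families of solutions with fixed real values at `0`, normalised so that their Wronskian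
is `1`. -/
structure IsFundamental (q : ℝ) (v : ℤ → ℝ) (a b a' b' : ℝ) (φ θ : ℂ → ℤ → ℂ) : Prop where
  φ_sol : ∀ z, IsSeqSolution q v z (φ z)
  θ_sol : ∀ z, IsSeqSolution q v z (θ z)
  φ_zero : ∀ z, SeqValuesAtZero q (φ z) a b
  θ_zero : ∀ z, SeqValuesAtZero q (θ z) a' b'
  normalised : (1 - q) ^ 2 / q * (a * b' - a' * b) = 1

variable {a b a' b' : ℝ} {φ θ : ℂ → ℤ → ℂ}

lemma IsFundamental.wronskian_eq_one (hq0 : 0 < q) (h : IsFundamental q v a b a' b' φ θ)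
    (z : ℂ) (n : ℤ) : seqWronskian q (φ z) (θ z) n = 1 := by
  refine eq_of_step_of_tendsto (f := seqWronskian q (φ z) (θ z)) (fun n => ?_) ?_ n
  · rw [seqWronskian_succ hq0 (h.φ_sol z) (h.θ_sol z)]; simp
  · have := seqWronskian_tendsto hq0 (h.φ_zero z) (h.θ_zero z)
    have hn := h.normalised
    rw [← Complex.ofReal_inj] at hn
    push_cast at hn
    rwa [hn] at this

/-- Green's formula on `(0, q ^ N]` for a solution `y` at `z` and a solution `G` at `w`. Subtracting
a solution at `w` with the values of `y` at `0` removes the boundary term at `0`. -/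
lemma seqWronskian_sub_eq (hq0 : 0 < q) (hq1 : q < 1) {z w : ℂ} {y y₀ G : ℤ → ℂ}
    {A B c d : ℂ} (hy : IsSeqSolution q v z y) (hy' : SeqValuesAtZero q y A B)
    (hy₀ : IsSeqSolution q v w y₀) (hy₀' : SeqValuesAtZero q y₀ A B)
    (hG : IsSeqSolution q v w G) (hG' : SeqValuesAtZero q G c d) (N : ℤ) :
    seqWronskian q (fun k => y k - y₀ k) G N = (z - w) * tailIntegral q y G N := by
  obtain ⟨Y, hY⟩ := hy'.exists_norm_le N
  obtain ⟨M, hM⟩ := hG'.exists_norm_le N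
  have key := eq_sub_tsum_of_step (f := seqWronskian q (fun k => y k - y₀ k) G)
    (d := fun k => (w - z) * (weight q k * y k * G k)) (L := 0) (fun n => ?_) ?_ N
    ((summable_tail hq0 hq1 hY hM).mul_left _)
  · rw [key, tsum_mul_left, tailIntegral]; ring
  · rw [seqWronskian_sub_left, seqWronskian_sub_left, seqWronskian_succ hq0 hy hG,
      seqWronskian_succ hq0 hy₀ hG]
    ring
  · simp only [seqWronskian_sub_left]
    simpa using (seqWronskian_tendsto hq0 hy' hG').sub (seqWronskian_tendsto hq0 hy₀' hG')

/-- Variation of parameters. -/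
lemma IsFundamental.sub_eq (hq0 : 0 < q) (hq1 : q < 1) (h : IsFundamental q v a b a' b' φ θ)
    {z w : ℂ} {y y₀ : ℤ → ℂ} {A B : ℂ} (hy : IsSeqSolution q v z y)
    (hy' : SeqValuesAtZero q y A B) (hy₀ : IsSeqSolution q v w y₀)
    (hy₀' : SeqValuesAtZero q y₀ A B) (N : ℤ) :
    y N - y₀ N = (z - w) * (tailIntegral q y (θ w) N * φ w N -
      tailIntegral q y (φ w) N * θ w N) := by
  have := eq_seqWronskian_mul_sub (y := fun k => y k - y₀ k) (h.wronskian_eq_one hq0 w N)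
  rw [seqWronskian_sub_eq hq0 hq1 hy hy' hy₀ hy₀' (h.θ_sol w) (h.θ_zero w),
    seqWronskian_sub_eq hq0 hq1 hy hy' hy₀ hy₀' (h.φ_sol w) (h.φ_zero w)] at this
  rw [this]; ring

lemma IsFundamental.eq_of_values (hq0 : 0 < q) (hq1 : q < 1)
    (h : IsFundamental q v a b a' b' φ θ) {z : ℂ} {y y₀ : ℤ → ℂ} {A B : ℂ}
    (hy : IsSeqSolution q v z y) (hy' : SeqValuesAtZero q y A B)
    (hy₀ : IsSeqSolution q v z y₀) (hy₀' : SeqValuesAtZero q y₀ A B) : y = y₀ := by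
  ext N
  rw [← sub_eq_zero, h.sub_eq hq0 hq1 hy hy' hy₀ hy₀' N, sub_self, zero_mul]

/-- Solutions with fixed values at `0` are entire functions of the spectral parameter.
Variation of parameters around `w` bounds `y z - y w` on `(0, q ^ N]` by a multiple of
`|z - w|`, and inserting this bound in the same formula gives the derivative; no power series in
`z` is needed. -/
lemma IsFundamental.differentiable (hq0 : 0 < q) (hq1 : q < 1)
    (h : IsFundamental q v a b a' b' φ θ) {y : ℂ → ℤ → ℂ} {A B : ℂ}
    (hy : ∀ z, IsSeqSolution q v z (y z)) (hy' : ∀ z, SeqValuesAtZero q (y z) A B) (N : ℤ) :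
    Differentiable ℂ fun z => y z N := by
  intro w
  obtain ⟨M₁, hM₁⟩ := (h.φ_zero w).exists_norm_le N
  obtain ⟨M₂, hM₂⟩ := (h.θ_zero w).exists_norm_le N
  obtain ⟨Y₀, hY₀⟩ := (hy' w).exists_norm_le N
  have hM₁0 : 0 ≤ M₁ := (norm_nonneg _).trans (hM₁ 0)
  have hM₂0 : 0 ≤ M₂ := (norm_nonneg _).trans (hM₂ 0)
  have hY₀0 : 0 ≤ Y₀ := (norm_nonneg _).trans (hY₀ 0)
  set C : ℝ := 2 * q ^ N * (M₁ * M₂) with hC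
  have hqN : 0 < q ^ N := zpow_pos hq0 N
  have hC0 : 0 ≤ C := by positivity
  -- the integral operator of variation of parameters has norm at most `C` on `(0, q ^ N]`
  have hop : ∀ {x : ℤ → ℂ} {Y : ℝ}, (∀ k : ℕ, ‖x (N + k)‖ ≤ Y) → ∀ j : ℕ,
      ‖tailIntegral q x (θ w) (N + j) * φ w (N + j) -
        tailIntegral q x (φ w) (N + j) * θ w (N + j)‖ ≤ C * Y := by
    intro x Y hx j
    have hY0 : 0 ≤ Y := (norm_nonneg _).trans (hx 0)
    have hshift : ∀ {u : ℤ → ℂ} {U : ℝ}, (∀ k : ℕ, ‖u (N + k)‖ ≤ U) →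
        ∀ k : ℕ, ‖u (N + j + k)‖ ≤ U := fun hu k => by
      rw [add_assoc, ← Nat.cast_add]; exact hu _
    have hqj : q ^ (N + j) ≤ q ^ N := by
      rw [zpow_add₀ hq0.ne', zpow_natCast]
      exact mul_le_of_le_one_right hqN.le (pow_le_one₀ hq0.le hq1.le)
    have h1 := norm_tailIntegral_le hq0 hq1 (hshift hx) (hshift hM₂)
    have h2 := norm_tailIntegral_le hq0 hq1 (hshift hx) (hshift hM₁)
    calc _ ≤ ‖tailIntegral q x (θ w) (N + j)‖ * ‖φ w (N + j)‖ +
          ‖tailIntegral q x (φ w) (N + j)‖ * ‖θ w (N + j)‖ := by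
            rw [← norm_mul, ← norm_mul]; exact norm_sub_le _ _
      _ ≤ (q ^ N * (Y * M₂)) * M₁ + (q ^ N * (Y * M₁)) * M₂ := by
          have h3 := hM₁ j
          have h4 := hM₂ j
          gcongr
          · exact h1.trans (by gcongr)
          · exact h2.trans (by gcongr)
      _ = C * Y := by rw [hC]; ring
  have hsub : ∀ z i, y z i - y w i = (z - w) * (tailIntegral q (y z) (θ w) i * φ w i -
      tailIntegral q (y z) (φ w) i * θ w i) := fun z i =>
    h.sub_eq hq0 hq1 (hy z) (hy' z) (hy w) (hy' w) i
  -- a priori bound for `y z - y w`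
  have hnear : ∀ᶠ z in 𝓝 w, ∀ k : ℕ, ‖y z (N + k) - y w (N + k)‖ ≤ ‖z - w‖ * (C * (2 * Y₀)) := by
    have : ∀ᶠ z in 𝓝 w, ‖z - w‖ * C < 1 / 2 := by
      have : Tendsto (fun z => ‖z - w‖ * C) (𝓝 w) (𝓝 (‖w - w‖ * C)) :=
        Continuous.tendsto (by fun_prop) w
      rw [sub_self, norm_zero, zero_mul] at this
      exact this.eventually_lt_const (by norm_num)
    filter_upwards [this] with z hz
    obtain ⟨Y', hY'⟩ := (hy' z).exists_norm_le N
    set Y : ℝ := ⨆ k : ℕ, ‖y z (N + k)‖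
    have hY : ∀ k : ℕ, ‖y z (N + k)‖ ≤ Y :=
      fun k => le_ciSup (f := fun k : ℕ => ‖y z (N + k)‖) ⟨Y', by rintro _ ⟨k, rfl⟩; exact hY' k⟩ k
    have hY0 : 0 ≤ Y := (norm_nonneg _).trans (hY 0)
    have hd : ∀ k : ℕ, ‖y z (N + k) - y w (N + k)‖ ≤ ‖z - w‖ * (C * Y) := fun k => by
      rw [hsub, norm_mul]
      have := hop hY k
      gcongr
    have hYle : Y ≤ 2 * Y₀ := by
      have : Y ≤ Y₀ + ‖z - w‖ * (C * Y) := ciSup_le fun k => by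
        have h1 := norm_sub_norm_le (y z (N + k)) (y w (N + k))
        have h2 := hd k
        have h3 := hY₀ k
        linarith
      nlinarith
    intro k
    exact (hd k).trans (by gcongr)
  set E := tailIntegral q (y w) (θ w) N * φ w N - tailIntegral q (y w) (φ w) N * θ w N
  refine HasDerivAt.differentiableAt (f' := E) ?_
  rw [hasDerivAt_iff_isLittleO]
  refine Asymptotics.IsBigO.trans_isLittleO (g := fun z => ‖z - w‖ ^ 2) ?_
    (Asymptotics.isLittleO_pow_sub_sub w one_lt_two)
  refine Asymptotics.IsBigO.of_bound (C * (C * (2 * Y₀))) ?_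
  filter_upwards [hnear] with z hz
  have htail : ∀ {G : ℤ → ℂ} {M : ℝ}, (∀ k : ℕ, ‖G (N + k)‖ ≤ M) →
      tailIntegral q (fun k => y z k - y w k) G N =
        tailIntegral q (y z) G N - tailIntegral q (y w) G N := by
    intro G M hG
    obtain ⟨Y', hY'⟩ := (hy' z).exists_norm_le N
    rw [tailIntegral, tailIntegral, tailIntegral, ← Summable.tsum_sub
      (summable_tail hq0 hq1 hY' hG) (summable_tail hq0 hq1 hY₀ hG)]
    exact tsum_congr fun k => by ring
  have hfin := hop (x := fun k => y z k - y w k) hz 0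
  simp only [Nat.cast_zero, add_zero] at hfin
  rw [htail hM₁, htail hM₂] at hfin
  have heq : y z N - y w N - (z - w) • E = (z - w) *
      ((tailIntegral q (y z) (θ w) N - tailIntegral q (y w) (θ w) N) * φ w N -
        (tailIntegral q (y z) (φ w) N - tailIntegral q (y w) (φ w) N) * θ w N) := by
    rw [hsub z N, smul_eq_mul]; ring
  rw [heq, norm_mul, norm_pow, norm_norm]
  calc _ ≤ ‖z - w‖ * (C * (‖z - w‖ * (C * (2 * Y₀)))) := by gcongr
    _ = _ := by ring

lemma IsSeqSolution.conj {z : ℂ} {F : ℤ → ℂ} (hF : IsSeqSolution q v z F) :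
    IsSeqSolution q v (starRingEnd ℂ z) fun n => starRingEnd ℂ (F n) := by
  intro n
  simp only [hF n, map_sub, map_mul, map_add, map_one, map_pow, map_zpow₀, Complex.conj_ofReal]

lemma SeqValuesAtZero.conj {F : ℤ → ℂ} {A B : ℂ} (hF : SeqValuesAtZero q F A B) :
    SeqValuesAtZero q (fun n => starRingEnd ℂ (F n)) (starRingEnd ℂ A) (starRingEnd ℂ B) := by
  refine ⟨(Complex.continuous_conj.tendsto A).comp hF.1, ?_⟩
  refine ((Complex.continuous_conj.tendsto B).comp hF.2).congr fun n => ?_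
  simp

/-- For a real spectral parameter `φ` is real, since its conjugate solves the same problem. -/
lemma IsFundamental.φ_real (hq0 : 0 < q) (hq1 : q < 1) (h : IsFundamental q v a b a' b' φ θ)
    (x : ℝ) (n : ℤ) : ((φ x n).re : ℂ) = φ x n := by
  have h1 := (h.φ_sol x).conj
  have h2 := (h.φ_zero x).conj
  rw [Complex.conj_ofReal] at h1
  rw [Complex.conj_ofReal, Complex.conj_ofReal] at h2
  exact Complex.conj_eq_iff_re.1
    (congrFun (h.eq_of_values hq0 hq1 h1 h2 (h.φ_sol x) (h.φ_zero x)) n)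

lemma IsFundamental.exists_φ_ne_zero (hq0 : 0 < q) (h : IsFundamental q v a b a' b' φ θ)
    (z : ℂ) : ∃ n, φ z n ≠ 0 := by
  by_contra! h0
  have := h.wronskian_eq_one hq0 z 0
  simp [seqWronskian, h0] at this

end Family

/-! ### Weyl solutions and bounds for the Green function -/

/-- The imaginary part `W(F, conj F) / 2i` of the Wronskian of a sequence and its conjugate. For
a solution its increment from `n` to `n + 1` is `- Im z` times the term of index `n` in the Jackson
integral of `|F|²`. -/
noncomputable def energyFlux (q : ℝ) (F : ℤ → ℂ) (n : ℤ) : ℝ :=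
  (1 - q) * (q ^ n)⁻¹ * (F n * starRingEnd ℂ (F (n - 1))).im

/-- The Weyl solution `θ + l φ`. -/
def weylSeq (φ θ : ℤ → ℂ) (l : ℂ) (n : ℤ) : ℂ := θ n + l * φ n

/-- A fundamental family together with a function `m`, meromorphic in the plane and analytic off
the real axis, such that for non-real `z` the number `m z` is a limit of numbers `l N` for which
`θ + l N φ` satisfies a real boundary condition at `q ^ (-N)`, that is, has no energy flux
there. -/
structure IsWeylSystem (q : ℝ) (v : ℤ → ℝ) (a b a' b' : ℝ) (φ θ : ℂ → ℤ → ℂ) (m : ℂ → ℂ) : Prop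
    extends IsFundamental q v a b a' b' φ θ where
  weyl : ∀ z : ℂ, z.im ≠ 0 → ∃ l : ℕ → ℂ,
    (∀ N : ℕ, energyFlux q (weylSeq (φ z) (θ z) (l N)) (-N) = 0) ∧ Tendsto l atTop (𝓝 (m z))
  analyticAt : ∀ z : ℂ, z.im ≠ 0 → AnalyticAt ℂ m z
  meromorphicAt : ∀ z : ℂ, MeromorphicAt m z

section Weyl

variable {q : ℝ} {v : ℤ → ℝ} {a b a' b' : ℝ} {φ θ : ℂ → ℤ → ℂ} {m : ℂ → ℂ}

lemma IsSeqSolution.weylSeq {z : ℂ} {F G : ℤ → ℂ} (hF : IsSeqSolution q v z F)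
    (hG : IsSeqSolution q v z G) (l : ℂ) : IsSeqSolution q v z (weylSeq F G l) := by
  intro n
  simp only [QSturm.weylSeq, hF n, hG n]
  ring

lemma energyFlux_succ (hq0 : 0 < q) {z : ℂ} {F : ℤ → ℂ} (hF : IsSeqSolution q v z F) (n : ℤ) :
    energyFlux q F (n + 1) = energyFlux q F n - z.im * (weight q n * ‖F n‖ ^ 2) := by
  have hqn : q ^ n ≠ 0 := zpow_ne_zero _ hq0.ne'
  have hc : (q : ℂ) ^ n = ((q ^ n : ℝ) : ℂ) := by push_cast; rfl
  simp only [energyFlux, weight, add_sub_cancel_right, hF n, zpow_add_one₀ hq0.ne', hc,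
    ← Complex.normSq_eq_norm_sq, Complex.normSq_apply]
  generalize q ^ n = x at *
  rw [show ((q : ℂ) * (x : ℂ) ^ 2 * (z - v n)) = ((q * x ^ 2 : ℝ) : ℂ) * (z - v n) by push_cast; rfl,
    show (1 + q : ℂ) = ((1 + q : ℝ) : ℂ) by push_cast; rfl]
  simp only [Complex.mul_im, Complex.mul_re, Complex.sub_re, Complex.sub_im, Complex.ofReal_re,
    Complex.ofReal_im, Complex.conj_re, Complex.conj_im]
  field_simp
  ring

lemma energyFlux_eq (F : ℤ → ℂ) (n : ℤ) :
    energyFlux q F n = (seqWronskian q F (fun k => starRingEnd ℂ (F k)) n).im / 2 := by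
  have hc : (1 - q : ℂ) * ((q : ℂ) ^ n)⁻¹ = (((1 - q) * (q ^ n)⁻¹ : ℝ) : ℂ) := by push_cast; rfl
  rw [energyFlux, seqWronskian, hc, Complex.im_ofReal_mul]
  simp only [Complex.sub_im, Complex.mul_im, Complex.conj_re, Complex.conj_im]
  ring

lemma energyFlux_tendsto (hq0 : 0 < q) {F : ℤ → ℂ} {A B : ℂ} (hF : SeqValuesAtZero q F A B) :
    Tendsto (fun n : ℕ => energyFlux q F n) atTop
      (𝓝 ((1 - q) ^ 2 / q * (A * starRingEnd ℂ B).im)) := by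
  simp only [energyFlux_eq]
  have h := ((Complex.continuous_im.tendsto _).comp
    (seqWronskian_tendsto hq0 hF hF.conj)).div_const 2
  convert h using 2
  · rfl
  have hc : (1 - q : ℂ) ^ 2 / q = (((1 - q) ^ 2 / q : ℝ) : ℂ) := by push_cast; rfl
  rw [hc, Complex.im_ofReal_mul]
  simp only [Complex.sub_im, Complex.mul_im, Complex.conj_re, Complex.conj_im]
  ring

/-- `Im z` times the energy flux decreases as the grid point `q ^ n` moves to the endpoint `0`. -/
lemma energyFlux_antitone (hq0 : 0 < q) (hq1 : q < 1) {z : ℂ} {F : ℤ → ℂ}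
    (hF : IsSeqSolution q v z F) : Antitone fun n => z.im * energyFlux q F n := by
  refine antitone_int_of_succ_le fun n => ?_
  have hw := weight_pos hq0 hq1 n
  have : 0 ≤ z.im ^ 2 * (weight q n * ‖F n‖ ^ 2) := by positivity
  rw [energyFlux_succ hq0 hF]
  nlinarith

/-- The flux of `φ` dominates every term of the Jackson integral of `|φ|²` over `(0, q ^ n]`,
because it vanishes at `0`. -/
lemma IsFundamental.le_energyFlux_φ (hq0 : 0 < q) (hq1 : q < 1)
    (h : IsFundamental q v a b a' b' φ θ) (z : ℂ) {j n : ℤ} (hj : n ≤ j) :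
    z.im ^ 2 * (weight q j * ‖φ z j‖ ^ 2) ≤ z.im * energyFlux q (φ z) n := by
  have hanti := energyFlux_antitone hq0 hq1 (h.φ_sol z)
  have hlim := (energyFlux_tendsto hq0 (h.φ_zero z)).const_mul z.im
  simp only [Complex.conj_ofReal, ← Complex.ofReal_mul, Complex.ofReal_im, mul_zero] at hlim
  have h0 : 0 ≤ z.im * energyFlux q (φ z) (j + 1) := by
    refine le_of_tendsto hlim ?_
    filter_upwards [eventually_ge_atTop (j + 1).toNat] with k hk
    exact hanti (Int.toNat_le.1 hk)
  have h1 : z.im * energyFlux q (φ z) j ≤ z.im * energyFlux q (φ z) n := hanti hj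
  rw [energyFlux_succ hq0 (h.φ_sol z) j] at h0
  nlinarith

/-- The sign of the flux of the Weyl solution: for `θ + l φ` with `l` on the Weyl circle at `b` it
follows from monotonicity between `b` and `q ^ n`, and it survives the limit `b → ∞`. -/
lemma IsWeylSystem.energyFlux_ψ_nonpos (hq0 : 0 < q) (hq1 : q < 1)
    (h : IsWeylSystem q v a b a' b' φ θ m) {z : ℂ} (hz : z.im ≠ 0) (n : ℤ) :
    z.im * energyFlux q (weylSeq (φ z) (θ z) (m z)) n ≤ 0 := by
  obtain ⟨l, hl, hlim⟩ := h.weyl z hz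
  have hcont : Continuous fun c : ℂ => z.im * energyFlux q (weylSeq (φ z) (θ z) c) n := by
    unfold energyFlux weylSeq
    have := Complex.continuous_conj
    fun_prop
  refine le_of_tendsto ((hcont.tendsto _).comp hlim) ?_
  filter_upwards [eventually_ge_atTop (-n).toNat] with N hN
  have h1 := energyFlux_antitone hq0 hq1 ((h.φ_sol z).weylSeq (h.θ_sol z) (l N))
    (show -(N : ℤ) ≤ n by have := Int.toNat_le.1 hN; omega)
  simpa only [hl, mul_zero, Function.comp_apply] using h1

lemma SeqValuesAtZero.weylSeq {F G : ℤ → ℂ} {A B A' B' : ℂ} (hF : SeqValuesAtZero q F A B)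
    (hG : SeqValuesAtZero q G A' B') (l : ℂ) :
    SeqValuesAtZero q (weylSeq F G l) (A' + l * A) (B' + l * B) := by
  refine ⟨hG.1.add (hF.1.const_mul l), ?_⟩
  refine (hG.2.add (hF.2.const_mul l)).congr fun n => ?_
  rw [QSturm.weylSeq]
  ring

/-- `m` maps each half-plane to the closure of the opposite one: `Im m(z)` is the limit at `0`
of the energy flux of the Weyl solution. -/
lemma IsWeylSystem.im_mul_im_nonpos (hq0 : 0 < q) (hq1 : q < 1)
    (h : IsWeylSystem q v a b a' b' φ θ m) {z : ℂ} (hz : z.im ≠ 0) : z.im * (m z).im ≤ 0 := by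
  have hlim := (energyFlux_tendsto hq0 ((h.φ_zero z).weylSeq (h.θ_zero z) (m z))).const_mul z.im
  have hval : (1 - q) ^ 2 / q * ((a' + m z * a) * starRingEnd ℂ (b' + m z * b)).im =
      (m z).im := by
    have := h.normalised
    simp only [map_add, map_mul, Complex.conj_ofReal, Complex.mul_im, Complex.add_re,
      Complex.add_im, Complex.mul_re, Complex.conj_re, Complex.conj_im, Complex.ofReal_re,
      Complex.ofReal_im]
    linear_combination (m z).im * this
  rw [hval] at hlim
  exact le_of_tendsto hlim (.of_forall fun n => h.energyFlux_ψ_nonpos hq0 hq1 hz n)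

lemma seqWronskian_weylSeq {F G : ℤ → ℂ} {n : ℤ} (l : ℂ) :
    seqWronskian q F (weylSeq F G l) n = seqWronskian q F G n := by
  simp only [seqWronskian, weylSeq]; ring

/-- For two sequences with Wronskian `1`, the energy fluxes combine to `- Im (F G)`. -/
lemma norm_sq_mul_energyFlux_sub {F G : ℤ → ℂ} {n : ℤ} (h : seqWronskian q F G n = 1) :
    ‖G n‖ ^ 2 * energyFlux q F n - ‖F n‖ ^ 2 * energyFlux q G n = -(F n * G n).im := by
  have hc : (1 - q : ℂ) * ((q : ℂ) ^ n)⁻¹ = (((1 - q) * (q ^ n)⁻¹ : ℝ) : ℂ) := by push_cast; rfl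
  rw [seqWronskian, hc] at h
  simp only [energyFlux, ← Complex.normSq_eq_norm_sq, Complex.normSq_apply]
  generalize (1 - q) * (q ^ n)⁻¹ = c at *
  have hre := congrArg Complex.re h
  have him := congrArg Complex.im h
  rw [Complex.re_ofReal_mul] at hre
  rw [Complex.im_ofReal_mul] at him
  simp only [Complex.sub_re, Complex.sub_im, Complex.mul_im, Complex.mul_re,
    Complex.conj_re, Complex.conj_im, Complex.one_re, Complex.one_im] at *
  generalize (F n).re = x1 at *
  generalize (F n).im = x2 at *
  generalize (G n).re = y1 at *
  generalize (G n).im = y2 at *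
  linear_combination (-(x1 * y2 + x2 * y1)) * hre + (x1 * y1 - x2 * y2) * him

/-- The basic bound for the Green function `φ(x) ψ(y)`, `x ≤ y`: the resolvent has norm at most
`1 / |Im z|`. The energy identity on `(0, y]` and the sign of the flux of `ψ` at `y` bound the
Jackson integral of `|φ(x) ψ(y)|²` over `x ≤ y` by `|φ(y) ψ(y)| / |Im z|`. -/
lemma IsWeylSystem.exists_norm_green_le (hq0 : 0 < q) (hq1 : q < 1)
    (h : IsWeylSystem q v a b a' b' φ θ m) {j k : ℤ} (hjk : k ≤ j) :
    ∃ C : ℝ, ∀ z : ℂ, z.im ≠ 0 →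
      ‖φ z j * weylSeq (φ z) (θ z) (m z) k‖ ≤ C / |z.im| := by
  have main : ∀ {i : ℤ}, k ≤ i → ∀ {z : ℂ}, z.im ≠ 0 →
      weight q i * (|z.im| * ‖φ z i * weylSeq (φ z) (θ z) (m z) k‖) ^ 2 ≤
        |z.im| * ‖φ z k * weylSeq (φ z) (θ z) (m z) k‖ := by
    intro i hi z hz
    set ψ := weylSeq (φ z) (θ z) (m z) with hψ
    have hW : seqWronskian q (φ z) ψ k = 1 := by
      rw [hψ, seqWronskian_weylSeq]; exact h.wronskian_eq_one hq0 z k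
    have h1 := norm_sq_mul_energyFlux_sub hW
    have h2 := h.le_energyFlux_φ hq0 hq1 z hi
    have h3 := h.energyFlux_ψ_nonpos hq0 hq1 hz k
    have h4 : -(z.im * (φ z k * ψ k).im) ≤ |z.im| * ‖φ z k * ψ k‖ := by
      refine (neg_le_abs _).trans ?_
      rw [abs_mul]
      exact mul_le_mul_of_nonneg_left (Complex.abs_im_le_norm _) (abs_nonneg _)
    have h5 := mul_le_mul_of_nonneg_left h2 (sq_nonneg ‖ψ k‖)
    have h6 := mul_nonneg (sq_nonneg ‖φ z k‖) (neg_nonneg.2 h3)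
    have h7 : weight q i * (|z.im| * ‖φ z i * ψ k‖) ^ 2 =
        ‖ψ k‖ ^ 2 * (z.im ^ 2 * (weight q i * ‖φ z i‖ ^ 2)) := by
      rw [norm_mul, mul_pow, sq_abs]; ring
    rw [h7]
    linear_combination h5 + h6 + h4 + z.im * h1
  have hwk := weight_pos hq0 hq1 k
  have hwj := weight_pos hq0 hq1 j
  refine ⟨√((weight q j)⁻¹ * (weight q k)⁻¹), fun z hz => ?_⟩
  have hz' : 0 < |z.im| := abs_pos.2 hz
  have hk := main le_rfl hz
  have hj := main hjk hz
  rw [le_div_iff₀ hz', mul_comm]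
  refine Real.le_sqrt_of_sq_le ?_
  set X := |z.im| * ‖φ z k * weylSeq (φ z) (θ z) (m z) k‖ with hX
  have hX0 : 0 ≤ X := by positivity
  have hXle : X ≤ (weight q k)⁻¹ := by
    rcases hX0.eq_or_lt with h0 | h0
    · rw [← h0]; positivity
    · rw [← one_div, le_div_iff₀ hwk]
      by_contra! hlt
      nlinarith
  rw [inv_mul_eq_div, le_div_iff₀ hwj, mul_comm]
  exact hj.trans hXle

/-- The Green function is `δ(x, y) / z`, up to an error of order `1 / |Im z|` after
multiplication by `z`: solve the difference equation for the term containing `z`. -/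
lemma IsWeylSystem.exists_norm_mul_green_sub_le (hq0 : 0 < q) (hq1 : q < 1)
    (h : IsWeylSystem q v a b a' b' φ θ m) {j k : ℤ} (hjk : k ≤ j) :
    ∃ C : ℝ, ∀ z : ℂ, z.im ≠ 0 →
      ‖z * (φ z j * weylSeq (φ z) (θ z) (m z) k) - if j = k then ((weight q k)⁻¹ : ℂ) else 0‖ ≤
        C / |z.im| := by
  have hq : (q : ℂ) ≠ 0 := by exact_mod_cast hq0.ne'
  set D : ℂ := q * ((q : ℂ) ^ j) ^ 2 with hD
  have hD0 : D ≠ 0 := mul_ne_zero hq (pow_ne_zero _ (zpow_ne_zero _ hq))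
  have hcomb : ∀ {c₁ c₂ c₃ : ℂ} {x₁ x₂ x₃ X : ℂ} {C₁ C₂ C₃ s : ℝ}, ‖x₁‖ ≤ C₁ / s → ‖x₂‖ ≤ C₂ / s →
      ‖x₃‖ ≤ C₃ / s → X = c₁ * x₁ + c₂ * x₂ + c₃ * x₃ →
      ‖X‖ ≤ (‖c₁‖ * C₁ + ‖c₂‖ * C₂ + ‖c₃‖ * C₃) / s := by
    intro c₁ c₂ c₃ x₁ x₂ x₃ X C₁ C₂ C₃ s h1 h2 h3 hX
    calc ‖X‖ ≤ ‖c₁‖ * ‖x₁‖ + ‖c₂‖ * ‖x₂‖ + ‖c₃‖ * ‖x₃‖ := by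
          rw [hX, ← norm_mul, ← norm_mul, ← norm_mul]; exact norm_add₃_le
      _ ≤ ‖c₁‖ * (C₁ / s) + ‖c₂‖ * (C₂ / s) + ‖c₃‖ * (C₃ / s) := by gcongr
      _ = _ := by ring
  obtain ⟨C₁, h₁⟩ := h.exists_norm_green_le hq0 hq1 hjk
  obtain ⟨C₂, h₂⟩ := h.exists_norm_green_le hq0 hq1 (show k ≤ j + 1 by omega)
  rcases hjk.eq_or_lt with rfl | hlt
  · obtain ⟨C₃, h₃⟩ := h.exists_norm_green_le hq0 hq1 (show k - 1 ≤ k by omega)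
    refine ⟨_, fun z hz => hcomb (c₁ := (1 + q) / D + v k) (c₂ := -D⁻¹) (c₃ := -q / D)
      (h₁ z hz) (h₂ z hz) (h₃ z hz) ?_⟩
    set ψ := weylSeq (φ z) (θ z) (m z) with hψ
    have hW : seqWronskian q (φ z) ψ (k + 1) = 1 := by
      rw [hψ, seqWronskian_weylSeq]; exact h.wronskian_eq_one hq0 z _
    have hsol := ((h.φ_sol z).weylSeq (h.θ_sol z) (m z)) k
    rw [← hψ] at hsol
    have hqk : (q : ℂ) ^ k ≠ 0 := zpow_ne_zero _ hq
    have hq1' : (1 - q : ℂ) ≠ 0 := by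
      rw [sub_ne_zero]; exact_mod_cast hq1.ne'
    rw [seqWronskian, add_sub_cancel_right, zpow_add_one₀ hq, hsol] at hW
    rw [if_pos rfl, weight, hD]
    push_cast
    field_simp at hW ⊢
    linear_combination hW
  · obtain ⟨C₃, h₃⟩ := h.exists_norm_green_le hq0 hq1 (show k ≤ j - 1 by omega)
    refine ⟨_, fun z hz => hcomb (c₁ := (1 + q) / D + v j) (c₂ := -D⁻¹) (c₃ := -q / D)
      (h₁ z hz) (h₂ z hz) (h₃ z hz) ?_⟩
    have hsol := h.φ_sol z j
    rw [← hD] at hsol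
    rw [if_neg hlt.ne', hsol]
    field_simp
    ring

end Weyl

/-! ### Poles and residues of the Weyl function -/

section Residue

variable {q : ℝ} {v : ℤ → ℝ} {a b a' b' : ℝ} {φ θ : ℂ → ℤ → ℂ} {m : ℂ → ℂ}

/-- Real points are approached along the ray of direction `t + i`. -/
lemma tendsto_ray (p t : ℝ) :
    Tendsto (fun ε : ℝ => (p : ℂ) + ε * (t + Complex.I)) (𝓝[>] 0) (𝓝[≠] (p : ℂ)) := by
  refine tendsto_nhdsWithin_iff.2 ⟨?_, ?_⟩
  · have : Continuous fun ε : ℝ => (p : ℂ) + ε * (t + Complex.I) := by fun_prop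
    have h := this.tendsto 0
    simp only [Complex.ofReal_zero, zero_mul, add_zero] at h
    exact h.mono_left nhdsWithin_le_nhds
  · filter_upwards [self_mem_nhdsWithin] with ε hε h
    have := congrArg Complex.im h
    simp at this
    exact (ne_of_gt hε) this

lemma ray_im (p t ε : ℝ) : ((p : ℂ) + ε * (t + Complex.I)).im = ε := by simp

lemma IsWeylSystem.differentiable_φ (hq0 : 0 < q) (hq1 : q < 1)
    (h : IsWeylSystem q v a b a' b' φ θ m) (n : ℤ) : Differentiable ℂ fun z => φ z n :=
  h.toIsFundamental.differentiable hq0 hq1 h.φ_sol h.φ_zero n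

lemma IsWeylSystem.differentiable_θ (hq0 : 0 < q) (hq1 : q < 1)
    (h : IsWeylSystem q v a b a' b' φ θ m) (n : ℤ) : Differentiable ℂ fun z => θ z n :=
  h.toIsFundamental.differentiable hq0 hq1 h.θ_sol h.θ_zero n

lemma meromorphicAt_sub_mul {f : ℂ → ℂ} {p : ℂ} (hf : MeromorphicAt f p) :
    MeromorphicAt (fun w => (w - p) * f w) p :=
  ((MeromorphicAt.id p).sub (MeromorphicAt.const p p)).fun_mul hf

lemma meromorphicOrderAt_sub_mul {f : ℂ → ℂ} {p : ℂ} (hf : MeromorphicAt f p) :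
    meromorphicOrderAt (fun w => (w - p) * f w) p = 1 + meromorphicOrderAt f p := by
  have h1 : MeromorphicAt (fun w : ℂ => w - p) p := by fun_prop
  have h2 : meromorphicOrderAt (fun w : ℂ => w - p) p = 1 := by
    refine (meromorphicOrderAt_eq_int_iff (n := 1) h1).2 ⟨fun _ => 1, analyticAt_const, one_ne_zero, ?_⟩
    exact .of_forall fun w => by simp
  rw [← h2]
  exact meromorphicOrderAt_mul h1 hf

/-- `f` is analytic at `p`, up to its value there, if `(w - p) f(w)` tends to `0`. -/
lemma meromorphicOrderAt_nonneg_of_tendsto {f : ℂ → ℂ} {p : ℂ} (hf : MeromorphicAt f p)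
    (h : Tendsto (fun w => (w - p) * f w) (𝓝[≠] p) (𝓝 0)) : 0 ≤ meromorphicOrderAt f p := by
  have := (tendsto_zero_iff_meromorphicOrderAt_pos (meromorphicAt_sub_mul hf)).1 h
  rw [meromorphicOrderAt_sub_mul hf] at this
  generalize meromorphicOrderAt f p = o at *
  cases o with
  | top => exact le_top
  | coe o =>
    have h2 : (0 : ℤ) < 1 + o := by exact_mod_cast this
    have : (0 : ℤ) ≤ o := by omega
    exact_mod_cast this

lemma tendsto_of_meromorphicOrderAt_nonneg {f : ℂ → ℂ} {p : ℂ} (hf : MeromorphicAt f p)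
    (h : 0 ≤ meromorphicOrderAt f p) : Tendsto (fun w => (w - p) * f w) (𝓝[≠] p) (𝓝 0) := by
  refine (tendsto_zero_iff_meromorphicOrderAt_pos (meromorphicAt_sub_mul hf)).2 ?_
  rw [meromorphicOrderAt_sub_mul hf]
  exact lt_of_lt_of_le (by norm_num) (le_add_of_nonneg_right h)

/-- The poles of the Weyl function are simple: at a real point `p` the bound for
`φ(x, z) ψ(x, z)` with `φ(x, p) ≠ 0` gives `m(p + iε) = O(1 / ε)`. -/
lemma IsWeylSystem.tendsto_simplePoleResidue (hq0 : 0 < q) (hq1 : q < 1)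
    (h : IsWeylSystem q v a b a' b' φ θ m) (p : ℂ) :
    Tendsto (fun w => (w - p) * m w) (𝓝[≠] p) (𝓝 (simplePoleResidue m p)) := by
  refine tendsto_nhds_limUnder ?_
  rw [tendsto_nhds_iff_meromorphicOrderAt_nonneg (meromorphicAt_sub_mul (h.meromorphicAt p))]
  by_contra! hneg
  by_cases hp : p.im = 0
  swap
  · rw [meromorphicOrderAt_sub_mul (h.meromorphicAt p)] at hneg
    exact absurd hneg (not_lt.2 (add_nonneg zero_le_one
      (h.analyticAt p hp).meromorphicOrderAt_nonneg))
  obtain ⟨x, rfl⟩ : ∃ x : ℝ, (x : ℂ) = p := ⟨p.re, Complex.ext rfl hp.symm⟩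
  obtain ⟨n, hn⟩ := h.exists_φ_ne_zero hq0 x
  obtain ⟨C, hC⟩ := h.exists_norm_green_le hq0 hq1 (le_refl n)
  have hray := tendsto_ray x 0
  have hcob := ((tendsto_cobounded_iff_meromorphicOrderAt_neg
    (meromorphicAt_sub_mul (h.meromorphicAt x))).2 hneg).comp hray
  have hprod : Tendsto (fun ε : ℝ => ‖φ (x + ε * ((0 : ℝ) + Complex.I)) n‖ ^ 2) (𝓝[>] 0)
      (𝓝 (‖φ x n‖ ^ 2)) :=
    ((((h.differentiable_φ hq0 hq1 n).continuous.tendsto (x : ℂ)).mono_left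
      nhdsWithin_le_nhds).comp hray).norm.pow 2
  have hθ : Tendsto (fun ε : ℝ => ε * ‖φ (x + ε * ((0 : ℝ) + Complex.I)) n *
      θ (x + ε * ((0 : ℝ) + Complex.I)) n‖) (𝓝[>] 0) (𝓝 (0 * ‖φ x n * θ x n‖)) :=
    (tendsto_id.mono_left nhdsWithin_le_nhds).mul
      (((((h.differentiable_φ hq0 hq1 n).continuous.mul
        (h.differentiable_θ hq0 hq1 n).continuous).tendsto (x : ℂ)).mono_left
          nhdsWithin_le_nhds).comp hray).norm
  have hinf := (tendsto_norm_cobounded_atTop.comp hcob).atTop_mul_pos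
    (pow_pos (norm_pos_iff.2 hn) 2) hprod
  obtain ⟨ε, h1, h2, h3⟩ := ((hinf.eventually_gt_atTop (C + 1)).and
    ((hθ.eventually_lt_const (show 0 * ‖φ x n * θ x n‖ < 1 by simp)).and
      self_mem_nhdsWithin)).exists
  have hε : (0 : ℝ) < ε := h3
  simp only [Function.comp_apply] at h1
  have him := ray_im x 0 ε
  set w : ℂ := x + ε * ((0 : ℝ) + Complex.I) with hw
  have hgreen := hC w (by rw [him]; exact hε.ne')
  rw [him, abs_of_pos hε, le_div_iff₀ hε] at hgreen
  have hnorm : ‖w - x‖ = ε := by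
    rw [hw]; simp [abs_of_pos hε]
  have hid : m w * φ w n ^ 2 =
      φ w n * weylSeq (φ w) (θ w) (m w) n - φ w n * θ w n := by
    rw [weylSeq]; ring
  have h4 := norm_sub_le (φ w n * weylSeq (φ w) (θ w) (m w) n) (φ w n * θ w n)
  rw [← hid, norm_mul, norm_pow] at h4
  rw [norm_mul, hnorm] at h1
  nlinarith [mul_le_mul_of_nonneg_left h4 hε.le]

lemma IsWeylSystem.simplePoleResidue_eq_zero (hq0 : 0 < q) (hq1 : q < 1)
    (h : IsWeylSystem q v a b a' b' φ θ m) {p : ℂ} (hp : p ∉ poles m) :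
    simplePoleResidue m p = 0 :=
  tendsto_nhds_unique (h.tendsto_simplePoleResidue hq0 hq1 p)
    (tendsto_of_meromorphicOrderAt_nonneg (h.meromorphicAt p) (not_lt.1 hp))

/-- Residues at real points are non-negative: compare the sign of `Im m` along the rays
`p + ε (t + i)`, `ε > 0`, for all real `t`. -/
lemma IsWeylSystem.exists_simplePoleResidue_eq (hq0 : 0 < q) (hq1 : q < 1)
    (h : IsWeylSystem q v a b a' b' φ θ m) (p : ℝ) :
    ∃ r : ℝ, 0 ≤ r ∧ simplePoleResidue m p = r := by
  set r := simplePoleResidue m p with hr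
  have hray : ∀ t : ℝ, t * r.im ≤ r.re := by
    intro t
    have hlim := ((h.tendsto_simplePoleResidue hq0 hq1 p).comp (tendsto_ray p t)).mul_const
      ((t : ℂ) - Complex.I)
    have him := (Complex.continuous_im.tendsto _).comp hlim
    have hle : ∀ᶠ ε : ℝ in 𝓝[>] 0, (Complex.im ∘ fun ε : ℝ =>
        ((fun w => (w - p) * m w) ∘ fun ε : ℝ => (p : ℂ) + ε * (t + Complex.I)) ε *
          ((t : ℂ) - Complex.I)) ε ≤ 0 := by
      filter_upwards [self_mem_nhdsWithin] with ε hε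
      have hε' : (0 : ℝ) < ε := hε
      have hi := ray_im p t ε
      have hs := h.im_mul_im_nonpos hq0 hq1 (z := (p : ℂ) + ε * (t + Complex.I))
        (by rw [hi]; exact hε'.ne')
      rw [hi] at hs
      simp only [Function.comp_apply]
      set M := m ((p : ℂ) + ε * (t + Complex.I))
      have he : ((p : ℂ) + ε * (t + Complex.I) - p) * M * (t - Complex.I) =
          ((ε * (t ^ 2 + 1) : ℝ) : ℂ) * M := by
        push_cast
        linear_combination (-(ε : ℂ) * M) * Complex.I_sq
      rw [he, Complex.im_ofReal_mul]
      nlinarith [sq_nonneg t]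
    have := le_of_tendsto him hle
    rw [← hr] at this
    simp at this
    linarith
  have him : r.im = 0 := by
    by_contra hne
    have := hray ((r.re + 1) / r.im)
    rw [div_mul_cancel₀ _ hne] at this
    linarith
  have hre := hray 0
  rw [zero_mul] at hre
  exact ⟨r.re, hre, Complex.ext rfl (by simpa using him)⟩

/-- Only finitely many points of a family without repetition of poles lie in a given disc. -/
lemma finite_setOf_norm_lt {f : ℂ → ℂ} (hf : ∀ z, MeromorphicAt f z) {ι : Type*} {lam : ι → ℝ}
    (hinj : Function.Injective lam) (hlam : ∀ n, (lam n : ℂ) ∈ poles f) (R : ℝ) :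
    {n | |lam n| < R}.Finite := by
  have hfin : (Metric.closedBall (0 : ℂ) R ∩ poles f).Finite := by
    by_contra hinf
    obtain ⟨x, -, hx⟩ := Set.Infinite.exists_accPt_of_subset_isCompact hinf
      (isCompact_closedBall (0 : ℂ) R) Set.inter_subset_left
    rw [accPt_iff_frequently_nhdsNE] at hx
    refine hx ?_
    filter_upwards [(hf x).eventually_analyticAt] with y hy hmem
    exact absurd hmem.2 (not_lt.2 hy.meromorphicOrderAt_nonneg)
  refine Set.Finite.of_finite_image (f := fun n => (lam n : ℂ)) (hfin.subset ?_)
    fun x _ y _ hxy => hinj (Complex.ofReal_injective hxy)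
  rintro _ ⟨n, hn, rfl⟩
  refine ⟨?_, hlam n⟩
  simpa [Complex.norm_real] using (le_of_lt hn : |lam n| ≤ R)

end Residue

/-! ### A residue formula with a Riesz kernel -/

/-- On the circle `|z| = R` the kernel `1 - z² / R²` has absolute value `2 |Im z| / R`. -/
lemma norm_one_sub_sq_div {R : ℝ} (hR : 0 < R) {z : ℂ} (hz : ‖z‖ = R) :
    ‖1 - z ^ 2 / (R : ℂ) ^ 2‖ = 2 * |z.im| / R := by
  have hR' : (R : ℂ) ≠ 0 := by exact_mod_cast hR.ne'
  have h1 : z * starRingEnd ℂ z = (R : ℂ) ^ 2 := by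
    rw [Complex.mul_conj, Complex.normSq_eq_norm_sq, hz]; push_cast; rfl
  have h2 : 1 - z ^ 2 / (R : ℂ) ^ 2 = z * (starRingEnd ℂ z - z) / (R : ℂ) ^ 2 := by
    rw [mul_sub, h1]; field_simp
  have h3 : ‖starRingEnd ℂ z - z‖ = 2 * |z.im| := by
    rw [norm_sub_rev, Complex.sub_conj]
    simp
  rw [h2, norm_div, norm_mul, h3, hz, norm_pow, Complex.norm_real, Real.norm_of_nonneg hR.le]
  field_simp

/-- If `z h(z) → κ` at the rate `1 / |Im z|`, the Riesz means of the residues of `h` tend to `κ`.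
Integrate `(1 - z² / R²) h(z)` over the circle `|z| = R`: the kernel compensates the blow-up of
the bound at `± R`, and it cancels poles there. -/
lemma tendsto_riesz_mean_residues {ι : Type*} {lam : ι → ℝ} (hinj : Function.Injective lam)
    (hfin : ∀ R : ℝ, {n | |lam n| < R}.Finite) {h : ℂ → ℂ} {ρ : ℂ → ℂ} {κ : ℂ} {C : ℝ}
    (hmer : ∀ z, MeromorphicAt h z)
    (hres : ∀ p, Tendsto (fun w => (w - p) * h w) (𝓝[≠] p) (𝓝 (ρ p)))
    (hρ : ∀ p, p ∉ Set.range (fun n => (lam n : ℂ)) → ρ p = 0)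
    (hbd : ∀ z : ℂ, z.im ≠ 0 → ‖z * h z - κ‖ ≤ C / |z.im|) :
    Tendsto (fun R : ℝ => ∑ n ∈ (hfin R).toFinset, (1 - (lam n : ℂ) ^ 2 / (R : ℂ) ^ 2) * ρ (lam n))
      atTop (𝓝 κ) := by
  have hC : 0 ≤ C := by
    have := (norm_nonneg _).trans (hbd Complex.I (by simp))
    simpa using this
  have main : ∀ R : ℝ, 0 < R →
      ‖∑ n ∈ (hfin R).toFinset, (1 - (lam n : ℂ) ^ 2 / (R : ℂ) ^ 2) * ρ (lam n) - κ‖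
        ≤ 2 * C / R := by
    intro R hR
    have hR' : (R : ℂ) ≠ 0 := by exact_mod_cast hR.ne'
    set S := (hfin R).toFinset with hS
    have hmemS : ∀ {n}, n ∈ S ↔ |lam n| < R := fun {n} => by simp [hS]
    set c : ι → ℂ := fun n => (1 - (lam n : ℂ) ^ 2 / (R : ℂ) ^ 2) * ρ (lam n) with hc
    set T : ℂ → ℂ := fun w => ∑ n ∈ S, c n * (w - lam n)⁻¹ with hT
    set g : ℂ → ℂ := fun w => (1 - w ^ 2 / (R : ℂ) ^ 2) * h w + κ * w / (R : ℂ) ^ 2 - T w with hg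
    have hgmer : ∀ p, MeromorphicAt g p := fun p => by
      have := hmer p
      fun_prop
    -- all poles of `g` in the closed disc are removable
    have hgres : ∀ p, ‖p‖ ≤ R → Tendsto (fun w => (w - p) * g w) (𝓝[≠] p) (𝓝 0) := by
      intro p hp
      classical
      have hpole : ∀ n, Tendsto (fun w : ℂ => (w - p) * (c n * (w - lam n)⁻¹)) (𝓝[≠] p)
          (𝓝 (if p = lam n then c n else 0)) := by
        intro n
        split_ifs with hpn
        · refine tendsto_const_nhds.congr' ?_
          filter_upwards [self_mem_nhdsWithin] with w hw
          have : w - p ≠ 0 := sub_ne_zero.2 hw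
          rw [← hpn]
          field_simp
        · have h0 : p - lam n ≠ 0 := sub_ne_zero.2 hpn
          have : ContinuousAt (fun w : ℂ => (w - p) * (c n * (w - lam n)⁻¹)) p := by
            fun_prop (disch := exact h0)
          have h1 := this.tendsto
          rw [sub_self, zero_mul] at h1
          exact h1.mono_left nhdsWithin_le_nhds
      have hsum : Tendsto (fun w : ℂ => ∑ n ∈ S, (w - p) * (c n * (w - lam n)⁻¹)) (𝓝[≠] p)
          (𝓝 (∑ n ∈ S, if p = lam n then c n else 0)) :=
        tendsto_finsetSum _ fun n _ => hpole n
      have hk : Tendsto (fun w : ℂ => 1 - w ^ 2 / (R : ℂ) ^ 2) (𝓝[≠] p)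
          (𝓝 (1 - p ^ 2 / (R : ℂ) ^ 2)) :=
        (Continuous.tendsto (by fun_prop) p).mono_left nhdsWithin_le_nhds
      have hlin : Tendsto (fun w : ℂ => (w - p) * (κ * w / (R : ℂ) ^ 2)) (𝓝[≠] p)
          (𝓝 ((p - p) * (κ * p / (R : ℂ) ^ 2))) :=
        (Continuous.tendsto (by fun_prop) p).mono_left nhdsWithin_le_nhds
      have hall := ((hk.mul (hres p)).add hlin).sub hsum
      have hval : (1 - p ^ 2 / (R : ℂ) ^ 2) * ρ p + (p - p) * (κ * p / (R : ℂ) ^ 2) -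
          (∑ n ∈ S, if p = lam n then c n else 0) = 0 := by
        by_cases hpr : p ∈ Set.range (fun n => (lam n : ℂ))
        · obtain ⟨n, rfl⟩ := hpr
          simp only [Complex.ofReal_inj, hinj.eq_iff, Finset.sum_ite_eq, hmemS]
          split_ifs with hn
          · rw [hc]; ring
          · have : |lam n| = R := le_antisymm (by simpa [Complex.norm_real] using hp) (not_lt.1 hn)
            have h2 : (lam n : ℂ) ^ 2 = (R : ℂ) ^ 2 := by
              rw [← Complex.ofReal_pow, ← sq_abs, this, Complex.ofReal_pow]
            simp [h2, hR']
        · rw [hρ p hpr, Finset.sum_eq_zero]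
          · ring
          · intro n _
            rw [if_neg]
            rintro rfl
            exact hpr ⟨n, rfl⟩
      rw [hval] at hall
      refine hall.congr fun w => ?_
      rw [hg, hT]
      simp only [← Finset.mul_sum]
      ring
    set G := toMeromorphicNFOn g Set.univ with hG
    have hgon : MeromorphicOn g Set.univ := fun p _ => hgmer p
    have hGan : ∀ p, ‖p‖ ≤ R → AnalyticAt ℂ G p := fun p hp => by
      refine ((meromorphicNFOn_toMeromorphicNFOn g Set.univ)
        (Set.mem_univ p)).meromorphicOrderAt_nonneg_iff_analyticAt.1 ?_
      rw [meromorphicOrderAt_toMeromorphicNFOn hgon (Set.mem_univ p)]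
      exact meromorphicOrderAt_nonneg_of_tendsto (hgmer p) (hgres p hp)
    have hGint : (∮ z in C(0, R), G z) = 0 := by
      refine DiffContOnCl.circleIntegral_eq_zero hR.le (DifferentiableOn.diffContOnCl fun p hp => ?_)
      rw [closure_ball _ hR.ne'] at hp
      exact (hGan p (by simpa using hp)).differentiableAt.differentiableWithinAt
    have hGg : g =ᶠ[codiscreteWithin (Metric.sphere 0 |R|)] G :=
      (toMeromorphicNFOn_eqOn_codiscrete hgon).filter_mono (codiscreteWithin_mono (Set.subset_univ _))
    have hgint : (∮ z in C(0, R), g z) = 0 := by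
      rw [circleIntegral.circleIntegral_congr_codiscreteWithin hGg hR.ne', hGint]
    have hgI : CircleIntegrable g 0 R := by
      refine CircleIntegrable.congr_codiscreteWithin hGg.symm (ContinuousOn.circleIntegrable hR.le ?_)
      intro p hp
      exact (hGan p (by simp at hp; exact hp.le)).continuousAt.continuousWithinAt
    have hTI : ∀ n ∈ S, CircleIntegrable (fun w : ℂ => c n * (w - lam n)⁻¹) 0 R := by
      intro n hn
      have h1 : CircleIntegrable (fun w : ℂ => (w - lam n)⁻¹) 0 R := by
        rw [circleIntegrable_sub_inv_iff]
        right
        rw [mem_sphere_zero_iff_norm, Complex.norm_real, Real.norm_eq_abs, abs_of_pos hR]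
        exact (hmemS.1 hn).ne
      exact h1.const_smul (a := c n)
    have hTint : (∮ z in C(0, R), T z) = 2 * Real.pi * Complex.I * ∑ n ∈ S, c n := by
      rw [hT, circleIntegral.integral_fun_sum hTI, Finset.mul_sum]
      refine Finset.sum_congr rfl fun n hn => ?_
      rw [circleIntegral.integral_const_mul, circleIntegral.integral_sub_inv_of_mem_ball, mul_comm]
      rw [mem_ball_zero_iff, Complex.norm_real]
      exact hmemS.1 hn
    have h0I : CircleIntegrable (fun w : ℂ => κ * (w - 0)⁻¹) 0 R := by
      have h1 : CircleIntegrable (fun w : ℂ => (w - 0)⁻¹) 0 R := by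
        rw [circleIntegrable_sub_inv_iff]
        right
        simpa [abs_of_pos hR] using hR.ne
      exact h1.const_smul (a := κ)
    have h0int : (∮ z in C(0, R), κ * (z - 0)⁻¹) = 2 * Real.pi * Complex.I * κ := by
      rw [circleIntegral.integral_const_mul, circleIntegral.integral_sub_center_inv _ hR.ne', mul_comm]
    have hTI' : CircleIntegrable T 0 R := CircleIntegrable.fun_sum S hTI
    have herr : (∮ z in C(0, R), (g z - κ * (z - 0)⁻¹ + T z)) =
        2 * Real.pi * Complex.I * (∑ n ∈ S, c n - κ) := by
      rw [circleIntegral.integral_add (f := fun z => g z - κ * (z - 0)⁻¹) (hgI.sub h0I) hTI',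
        circleIntegral.integral_sub hgI h0I, hgint, h0int, hTint]
      ring
    have hbound : ‖∮ z in C(0, R), (g z - κ * (z - 0)⁻¹ + T z)‖ ≤
        2 * Real.pi * R * (2 * C / R ^ 2) := by
      refine circleIntegral.norm_integral_le_of_norm_le_const hR.le fun z hz => ?_
      have hz' : ‖z‖ = R := by simpa using hz
      have hz0 : z ≠ 0 := norm_pos_iff.1 (hz' ▸ hR)
      have he : g z - κ * (z - 0)⁻¹ + T z =
          (1 - z ^ 2 / (R : ℂ) ^ 2) * ((z * h z - κ) / z) := by
        rw [hg, sub_zero]; field_simp; ring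
      rw [he, norm_mul, norm_one_sub_sq_div hR hz', norm_div, hz']
      by_cases him : z.im = 0
      · rw [him]; simp; positivity
      · have hi : 0 < |z.im| := abs_pos.2 him
        calc _ ≤ 2 * |z.im| / R * ((C / |z.im|) / R) := by
              have := hbd z him
              gcongr
          _ = _ := by field_simp
    rw [herr, norm_mul] at hbound
    have hpi : ‖(2 * Real.pi * Complex.I : ℂ)‖ = 2 * Real.pi := by
      simp [abs_of_pos Real.pi_pos]
    rw [hpi] at hbound
    have h2 : 2 * Real.pi * R * (2 * C / R ^ 2) = 2 * Real.pi * (2 * C / R) := by field_simp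
    rw [h2] at hbound
    exact le_of_mul_le_mul_left hbound (by positivity)
  rw [tendsto_iff_norm_sub_tendsto_zero]
  have hlim : Tendsto (fun R : ℝ => 2 * C / R) atTop (𝓝 0) :=
    tendsto_const_nhds.div_atTop tendsto_id
  refine squeeze_zero' (.of_forall fun _ => norm_nonneg _) ?_ hlim
  filter_upwards [eventually_gt_atTop 0] with R hR using main R hR

/-! ### Parseval's identity from Riesz means -/

section Parseval

variable {ι J : Type*} {lam : ι → ℝ} {U : ι → J → ℝ}

/-- A finite Riesz mean tends to the full sum when the terms are non-negative. -/
lemma hasSum_of_tendsto_riesz_mean (hfin : ∀ R : ℝ, {n | |lam n| < R}.Finite) {t : ι → ℝ} {A : ℝ}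
    (ht : ∀ n, 0 ≤ t n)
    (h : Tendsto (fun R : ℝ => ∑ n ∈ (hfin R).toFinset, (1 - lam n ^ 2 / R ^ 2) * t n)
      atTop (𝓝 A)) : HasSum t A := by
  have hker : ∀ {R : ℝ} {n}, |lam n| < R →
      0 ≤ 1 - lam n ^ 2 / R ^ 2 ∧ 1 - lam n ^ 2 / R ^ 2 ≤ 1 := by
    intro R n hn
    have hR : 0 < R := (abs_nonneg _).trans_lt hn
    have : lam n ^ 2 / R ^ 2 ≤ 1 := by
      rw [div_le_one (by positivity), ← sq_abs]
      gcongr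
    have : 0 ≤ lam n ^ 2 / R ^ 2 := by positivity
    constructor <;> linarith
  have hle : ∀ F : Finset ι, ∑ n ∈ F, t n ≤ A := by
    intro F
    have h1 : Tendsto (fun R : ℝ => ∑ n ∈ F, (1 - lam n ^ 2 / R ^ 2) * t n) atTop
        (𝓝 (∑ n ∈ F, (1 - 0) * t n)) := by
      refine tendsto_finsetSum _ fun n _ => Tendsto.mul_const _ (tendsto_const_nhds.sub ?_)
      exact tendsto_const_nhds.div_atTop (tendsto_pow_atTop two_ne_zero)
    simp only [sub_zero, one_mul] at h1
    refine le_of_tendsto_of_tendsto h1 h ?_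
    have hF : ∀ᶠ R : ℝ in atTop, ∀ n ∈ F, |lam n| < R :=
      (Finset.eventually_all F).2 fun n _ => eventually_gt_atTop _
    filter_upwards [hF] with R hR
    refine Finset.sum_le_sum_of_subset_of_nonneg (fun n hn => by simpa using hR n hn) ?_
    intro n hn _
    exact mul_nonneg (hker (by simpa using hn)).1 (ht n)
  have hsum : Summable t := summable_of_sum_le ht hle
  refine (le_antisymm (hsum.tsum_le_of_sum_le hle) ?_ : ∑' n, t n = A) ▸ hsum.hasSum
  refine le_of_tendsto' h fun R => ?_
  refine le_trans (Finset.sum_le_sum fun n hn => ?_)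
    (hsum.sum_le_tsum (hfin R).toFinset fun n _ => ht n)
  exact mul_le_of_le_one_left (ht n) (hker (by simpa using hn)).2

lemma summable_mul_of_sq {x y : J → ℝ} (hx : Summable fun j => x j ^ 2)
    (hy : Summable fun j => y j ^ 2) : Summable fun j => x j * y j := by
  refine .of_norm_bounded (hx.add hy) fun j => ?_
  rw [Real.norm_eq_abs, abs_mul, ← sq_abs (x j), ← sq_abs (y j)]
  nlinarith [sq_nonneg (|x j| - |y j|), sq_nonneg (|x j|), sq_nonneg (|y j|)]

/-- `(p + i r)² = p² - r² + i ((p + r)² - p² - r²)`, summed. -/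
lemma hasSum_sq_add_I_mul {I' : Type*} {p r s : I' → ℝ} {P R S : ℝ}
    (hp : HasSum (fun i => p i ^ 2) P) (hr : HasSum (fun i => r i ^ 2) R)
    (hs : HasSum (fun i => s i ^ 2) S) (h : ∀ i, s i = p i + r i) :
    HasSum (fun i => ((p i : ℂ) + Complex.I * r i) ^ 2)
      ((P : ℂ) - R + Complex.I * (S - P - R)) := by
  have hp' := Complex.hasSum_ofReal.2 hp
  have hr' := Complex.hasSum_ofReal.2 hr
  have hs' := Complex.hasSum_ofReal.2 hs
  have h1 := (hp'.sub hr').add (((hs'.sub hp').sub hr').mul_left Complex.I)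
  have he : (fun i => ((p i : ℂ) + Complex.I * r i) ^ 2) = fun i => ((p i ^ 2 : ℝ) : ℂ) -
      ((r i ^ 2 : ℝ) : ℂ) + Complex.I * (((s i ^ 2 : ℝ) : ℂ) - ((p i ^ 2 : ℝ) : ℂ) -
        ((r i ^ 2 : ℝ) : ℂ)) := funext fun i => by
    rw [h i]
    push_cast
    linear_combination (r i : ℂ) ^ 2 * Complex.I_sq
  rw [he]
  exact h1

/-- The vectors `U n` resolve the identity in the sense of Riesz means: the means of
`U n j * U n k` over `|lam n| < R` with kernel `1 - (lam n)² / R²` tend to `δ j k`. -/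
def IsRieszResolution [DecidableEq J] (hfin : ∀ R : ℝ, {n | |lam n| < R}.Finite)
    (U : ι → J → ℝ) : Prop :=
  ∀ j k, Tendsto
    (fun R : ℝ => ∑ n ∈ (hfin R).toFinset, (1 - lam n ^ 2 / R ^ 2) * (U n j * U n k)) atTop
      (𝓝 (if j = k then 1 else 0))

variable [DecidableEq J] {hfin : ∀ R : ℝ, {n | |lam n| < R}.Finite}

/-- Parseval's identity for finitely supported vectors. -/
lemma IsRieszResolution.hasSum_sq_finset (hU : IsRieszResolution hfin U) (s : Finset J)
    (x : J → ℝ) : HasSum (fun n => (∑ j ∈ s, U n j * x j) ^ 2) (∑ j ∈ s, x j ^ 2) := by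
  refine hasSum_of_tendsto_riesz_mean hfin (fun n => sq_nonneg _) ?_
  have h : Tendsto (fun R : ℝ => ∑ j ∈ s, ∑ k ∈ s, x j * x k *
      ∑ n ∈ (hfin R).toFinset, (1 - lam n ^ 2 / R ^ 2) * (U n j * U n k)) atTop
      (𝓝 (∑ j ∈ s, ∑ k ∈ s, x j * x k * if j = k then 1 else 0)) :=
    tendsto_finsetSum _ fun j _ => tendsto_finsetSum _ fun k _ => (hU j k).const_mul _
  convert h using 2
  · rename_i R
    have hexp : ∀ n, (∑ j ∈ s, U n j * x j) ^ 2 =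
        ∑ j ∈ s, ∑ k ∈ s, (U n j * x j) * (U n k * x k) := fun n => by
      rw [sq, Finset.sum_mul_sum]
    simp only [hexp, Finset.mul_sum]
    rw [Finset.sum_comm]
    refine Finset.sum_congr rfl fun j _ => ?_
    rw [Finset.sum_comm]
    exact Finset.sum_congr rfl fun k _ => Finset.sum_congr rfl fun n _ => by ring
  · refine Finset.sum_congr rfl fun j hj => ?_
    simp [hj, sq]

/-- Each `U n` lies in the unit ball of `ℓ²`: test Bessel's inequality on truncations of `U n`
itself. -/
lemma IsRieszResolution.summable_sq (hU : IsRieszResolution hfin U) (n : ι) :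
    Summable fun j => U n j ^ 2 := by
  refine summable_of_sum_le (fun j => sq_nonneg _) (c := 1) fun s => ?_
  have h := hU.hasSum_sq_finset s (U n)
  have h1 := h.summable.le_tsum n fun k _ => sq_nonneg _
  rw [h.tsum_eq] at h1
  simp only [← sq] at h1
  by_contra! hlt
  nlinarith

/-- Parseval's identity for real vectors in `ℓ²`. Bessel's inequality passes to the limit along
truncations; applied to the remainders it shows that no mass is lost. -/
lemma IsRieszResolution.hasSum_sq (hU : IsRieszResolution hfin U) {x : J → ℝ}
    (hx : Summable fun j => x j ^ 2) :
    HasSum (fun n => (∑' j, U n j * x j) ^ 2) (∑' j, x j ^ 2) := by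
  have hUx : ∀ {y : J → ℝ}, (Summable fun j => y j ^ 2) → ∀ n,
      Summable fun j => U n j * y j := fun hy n =>
    summable_mul_of_sq (hU.summable_sq n) hy
  have bessel : ∀ {y : J → ℝ}, (Summable fun j => y j ^ 2) →
      ∀ F : Finset ι, ∑ n ∈ F, (∑' j, U n j * y j) ^ 2 ≤ ∑' j, y j ^ 2 := by
    intro y hy F
    have h1 : Tendsto (fun s : Finset J => ∑ n ∈ F, (∑ j ∈ s, U n j * y j) ^ 2) atTop
        (𝓝 (∑ n ∈ F, (∑' j, U n j * y j) ^ 2)) :=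
      tendsto_finsetSum _ fun n _ => Tendsto.pow (hUx hy n).hasSum 2
    refine le_of_tendsto' h1 fun s => ?_
    have h2 := hU.hasSum_sq_finset s y
    refine (h2.summable.sum_le_tsum F fun n _ => sq_nonneg _).trans ?_
    rw [h2.tsum_eq]
    exact hy.sum_le_tsum s fun j _ => sq_nonneg _
  have hsumm : ∀ {y : J → ℝ}, (Summable fun j => y j ^ 2) →
      Summable fun n => (∑' j, U n j * y j) ^ 2 := fun hy =>
    summable_of_sum_le (fun n => sq_nonneg _) (bessel hy)
  set B := ∑' n, (∑' j, U n j * x j) ^ 2 with hB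
  have hBle : B ≤ ∑' j, x j ^ 2 := (hsumm hx).tsum_le_of_sum_le (bessel hx)
  have hle : ∀ ε : ℝ, 0 < ε → ∑' j, x j ^ 2 ≤ (1 + ε) * B := by
    intro ε hε
    have htrunc : ∀ s : Finset J, ∑ j ∈ s, x j ^ 2 ≤
        (1 + ε) * B + (1 + ε⁻¹) * (∑' j, x j ^ 2 - ∑ j ∈ s, x j ^ 2) := by
      intro s
      -- the remainder of `x` outside `s`
      set d : J → ℝ := fun j => if j ∈ s then 0 else x j with hd
      have hdsq : ∀ j, d j ^ 2 = x j ^ 2 - if j ∈ s then x j ^ 2 else 0 := fun j => by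
        by_cases hj : j ∈ s <;> simp [hd, hj]
      have hfs : HasSum (fun j => if j ∈ s then x j ^ 2 else 0) (∑ j ∈ s, x j ^ 2) := by
        have := hasSum_sum_of_ne_finset_zero (f := fun j => if j ∈ s then x j ^ 2 else 0) (s := s)
          (L := .unconditional J) (fun j hj => if_neg hj)
        rwa [Finset.sum_congr rfl fun j hj => if_pos hj] at this
      have hdsum : HasSum (fun j => d j ^ 2) (∑' j, x j ^ 2 - ∑ j ∈ s, x j ^ 2) := by
        simp only [hdsq]; exact hx.hasSum.sub hfs
      have hQ : ∀ n, ∑ j ∈ s, U n j * x j = ∑' j, U n j * x j - ∑' j, U n j * d j := fun n => by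
        rw [← (hUx hx n).tsum_sub (hUx hdsum.summable n)]
        refine Eq.symm ((tsum_eq_sum fun j hj => ?_).trans (Finset.sum_congr rfl fun j hj => ?_))
        · simp [hd, hj]
        · simp [hd, hj]
      have h2 := hU.hasSum_sq_finset s x
      have h3 : HasSum (fun n => (1 + ε) * (∑' j, U n j * x j) ^ 2 +
          (1 + ε⁻¹) * (∑' j, U n j * d j) ^ 2)
          ((1 + ε) * B + (1 + ε⁻¹) * ∑' n, (∑' j, U n j * d j) ^ 2) :=
        ((hsumm hx).hasSum.mul_left _).add ((hsumm hdsum.summable).hasSum.mul_left _)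
      have h4 := hasSum_le (fun n => ?_) h2 h3
      · refine h4.trans ?_
        have h5 := (hsumm hdsum.summable).tsum_le_of_sum_le (bessel hdsum.summable)
        rw [hdsum.tsum_eq] at h5
        gcongr
      · rw [hQ]
        generalize ∑' j, U n j * x j = p
        generalize ∑' j, U n j * d j = r
        have : 0 ≤ ε⁻¹ * (ε * p + r) ^ 2 := by positivity
        have he : ε⁻¹ * (ε * p + r) ^ 2 = ε * p ^ 2 + 2 * p * r + ε⁻¹ * r ^ 2 := by
          field_simp; ring
        nlinarith
    have hlim : Tendsto (fun s : Finset J => ∑ j ∈ s, x j ^ 2) atTop (𝓝 (∑' j, x j ^ 2)) :=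
      hx.hasSum
    have hlim2 := ((hlim.const_sub (∑' j, x j ^ 2)).const_mul (1 + ε⁻¹)).const_add ((1 + ε) * B)
    have := le_of_tendsto_of_tendsto' hlim hlim2 htrunc
    simpa using this
  have hge : ∑' j, x j ^ 2 ≤ B := by
    have h1 : Tendsto (fun ε : ℝ => (1 + ε) * B) (𝓝[>] 0) (𝓝 ((1 + 0) * B)) :=
      (Continuous.tendsto (by fun_prop) 0).mono_left nhdsWithin_le_nhds
    rw [add_zero, one_mul] at h1
    refine ge_of_tendsto h1 ?_
    filter_upwards [self_mem_nhdsWithin] with ε hε using hle ε hε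
  rw [← le_antisymm hBle hge]
  exact (hsumm hx).hasSum

/-- The bilinear Parseval identity for complex vectors in `ℓ²`, by polarisation. -/
lemma IsRieszResolution.hasSum_sq_complex (hU : IsRieszResolution hfin U) {x : J → ℂ}
    (hx : Summable fun j => ‖x j‖ ^ 2) :
    (∀ n, Summable fun j => (U n j : ℂ) * x j) ∧
      HasSum (fun n => (∑' j, (U n j : ℂ) * x j) ^ 2) (∑' j, x j ^ 2) := by
  have hre : Summable fun j => (x j).re ^ 2 := by
    refine .of_nonneg_of_le (fun j => sq_nonneg _) (fun j => ?_) hx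
    rw [← sq_abs]
    gcongr
    exact Complex.abs_re_le_norm _
  have him : Summable fun j => (x j).im ^ 2 := by
    refine .of_nonneg_of_le (fun j => sq_nonneg _) (fun j => ?_) hx
    rw [← sq_abs]
    gcongr
    exact Complex.abs_im_le_norm _
  have hcross := summable_mul_of_sq hre him
  have hsum : Summable fun j => ((x j).re + (x j).im) ^ 2 := by
    refine ((hre.add him).add (hcross.mul_left 2)).congr fun j => ?_
    ring
  have hUre := fun n => summable_mul_of_sq (hU.summable_sq n) hre
  have hUim := fun n => summable_mul_of_sq (hU.summable_sq n) him
  have hcoeff : ∀ n, HasSum (fun j => (U n j : ℂ) * x j)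
      (((∑' j, U n j * (x j).re : ℝ) : ℂ) + Complex.I * ((∑' j, U n j * (x j).im : ℝ) : ℂ)) := by
    intro n
    have h := (Complex.hasSum_ofReal.2 (hUre n).hasSum).add
      ((Complex.hasSum_ofReal.2 (hUim n).hasSum).mul_left Complex.I)
    have he : (fun j => (U n j : ℂ) * x j) = fun j => ((U n j * (x j).re : ℝ) : ℂ) +
        Complex.I * ((U n j * (x j).im : ℝ) : ℂ) := funext fun j => by
      conv_lhs => rw [← Complex.re_add_im (x j)]
      push_cast
      ring
    rw [he]
    exact h
  refine ⟨fun n => (hcoeff n).summable, ?_⟩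
  have hadd : ∀ n, ∑' j, U n j * ((x j).re + (x j).im) =
      ∑' j, U n j * (x j).re + ∑' j, U n j * (x j).im := fun n => by
    rw [← (hUre n).tsum_add (hUim n)]
    exact tsum_congr fun j => by ring
  have hleft := hasSum_sq_add_I_mul (hU.hasSum_sq hre) (hU.hasSum_sq him) (hU.hasSum_sq hsum) hadd
  have hright := hasSum_sq_add_I_mul hre.hasSum him.hasSum hsum.hasSum fun j => rfl
  have hx2 : ∀ j, ((x j).re : ℂ) + Complex.I * (x j).im = x j := fun j => by
    rw [mul_comm]; exact Complex.re_add_im _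
  simp only [hx2] at hright
  rw [hright.tsum_eq]
  simp only [fun n => (hcoeff n).tsum_eq]
  exact hleft

end Parseval

/-! ### The eigenfunction expansion -/

section Expansion

variable {q : ℝ} {v : ℤ → ℝ} {a b a' b' : ℝ} {φ θ : ℂ → ℤ → ℂ} {m : ℂ → ℂ}

/-- The normalised eigenvectors `√(r w) φ` in `ℓ²(ℤ)`, where `r ≥ 0` is the residue of `m` at
the real point `x` and `w` the weight of Jackson's integral. -/
noncomputable def eigenvector (q : ℝ) (φ : ℂ → ℤ → ℂ) (m : ℂ → ℂ) (x : ℝ) (j : ℤ) : ℝ :=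
  √((simplePoleResidue m x).re * weight q j) * (φ x j).re

/-- The normalised eigenvectors resolve the identity: the Green function `φ(x) ψ(y)` has the
residues `r φ(x) φ(y)`. -/
lemma IsWeylSystem.isRieszResolution (hq0 : 0 < q) (hq1 : q < 1)
    (h : IsWeylSystem q v a b a' b' φ θ m) {ι : Type*} {lam : ι → ℝ}
    (hinj : Function.Injective lam) (hfin : ∀ R : ℝ, {n | |lam n| < R}.Finite)
    (hlam : Set.range (fun n => (lam n : ℂ)) = poles m) :
    IsRieszResolution hfin fun n => eigenvector q φ m (lam n) := by
  have key : ∀ {j k : ℤ}, k ≤ j → Tendsto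
      (fun R : ℝ => ∑ n ∈ (hfin R).toFinset, (1 - lam n ^ 2 / R ^ 2) *
        (eigenvector q φ m (lam n) j * eigenvector q φ m (lam n) k)) atTop
      (𝓝 (if j = k then 1 else 0)) := by
    intro j k hjk
    obtain ⟨C, hC⟩ := h.exists_norm_mul_green_sub_le hq0 hq1 hjk
    have hφ := fun n => h.differentiable_φ hq0 hq1 n
    have hθ := fun n => h.differentiable_θ hq0 hq1 n
    have hmer : ∀ z, MeromorphicAt (fun z => φ z j * weylSeq (φ z) (θ z) (m z) k) z := by
      intro z
      have h1 := ((hφ j).analyticAt z).meromorphicAt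
      have h2 := ((hφ k).analyticAt z).meromorphicAt
      have h3 := ((hθ k).analyticAt z).meromorphicAt
      exact h1.fun_mul (h3.fun_add ((h.meromorphicAt z).fun_mul h2))
    have hres : ∀ p, Tendsto (fun w => (w - p) * (φ w j * weylSeq (φ w) (θ w) (m w) k)) (𝓝[≠] p)
        (𝓝 (φ p j * φ p k * simplePoleResidue m p)) := by
      intro p
      have hcont : ∀ {g : ℂ → ℂ}, Differentiable ℂ g → Tendsto g (𝓝[≠] p) (𝓝 (g p)) :=
        fun hg => (hg.continuous.tendsto p).mono_left nhdsWithin_le_nhds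
      have hsub : Tendsto (fun w => w - p) (𝓝[≠] p) (𝓝 (p - p)) :=
        hcont (g := fun w => w - p) (by fun_prop)
      have hall := (hcont (hφ j)).mul ((hsub.mul (hcont (hθ k))).add
        ((h.tendsto_simplePoleResidue hq0 hq1 p).mul (hcont (hφ k))))
      have hval : φ p j * ((p - p) * θ p k + simplePoleResidue m p * φ p k) =
          φ p j * φ p k * simplePoleResidue m p := by ring
      rw [hval] at hall
      refine hall.congr fun w => ?_
      rw [weylSeq]; ring
    have hlim := tendsto_riesz_mean_residues hinj hfin hmer hres (fun p hp => by
      rw [hlam] at hp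
      rw [h.simplePoleResidue_eq_zero hq0 hq1 hp, mul_zero]) hC
    have hwj := weight_pos hq0 hq1 j
    have hwk := weight_pos hq0 hq1 k
    have hre := ((Complex.continuous_re.tendsto _).comp hlim).const_mul
      (√(weight q j) * √(weight q k))
    convert hre using 2
    · rename_i R
      rw [Function.comp_apply, Complex.re_sum, Finset.mul_sum]
      refine Finset.sum_congr rfl fun n _ => ?_
      obtain ⟨r, hr0, hr⟩ := h.exists_simplePoleResidue_eq hq0 hq1 (lam n)
      rw [eigenvector, eigenvector, hr, ← h.φ_real hq0 hq1 (lam n) j,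
        ← h.φ_real hq0 hq1 (lam n) k, Complex.ofReal_re, Real.sqrt_mul hr0, Real.sqrt_mul hr0]
      simp only [Complex.ofReal_re]
      have hterm : (1 - (lam n : ℂ) ^ 2 / (R : ℂ) ^ 2) * (((φ (lam n) j).re : ℂ) *
          ((φ (lam n) k).re : ℂ) * (r : ℂ)) = (((1 - lam n ^ 2 / R ^ 2) * ((φ (lam n) j).re *
            (φ (lam n) k).re * r) : ℝ) : ℂ) := by push_cast; rfl
      rw [hterm, Complex.ofReal_re]
      have := Real.mul_self_sqrt hr0
      linear_combination ((1 - lam n ^ 2 / R ^ 2) * (√(weight q j) * (φ (lam n) j).re *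
        (√(weight q k) * (φ (lam n) k).re))) * this
    · split_ifs with hjk'
      · subst hjk'
        rw [Real.mul_self_sqrt hwj.le, ← Complex.ofReal_inv, Complex.ofReal_re,
          mul_inv_cancel₀ hwj.ne']
      · simp
  intro j k
  rcases le_total k j with hjk | hjk
  · exact key hjk
  · have := key hjk
    simp only [eq_comm (a := k), mul_comm (eigenvector q φ m _ k)] at this
    exact this

/-- The values of a function at the points of the grid. -/
noncomputable def gridSeq (q : ℝ) (g : ℝ → ℂ) (n : ℤ) : ℂ := g (q ^ n)

lemma IsSolution.gridSeq (hq0 : 0 < q) {u : ℝ → ℝ} {z : ℂ} {g : ℝ → ℂ}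
    (hg : IsSolution q u z g) : IsSeqSolution q (fun n => u (q ^ n)) z (gridSeq q g) := by
  intro n
  have hq : (q : ℂ) ≠ 0 := by exact_mod_cast hq0.ne'
  have hqn : (q : ℂ) ^ n ≠ 0 := zpow_ne_zero _ hq
  have h := hg (q ^ n) ⟨n, rfl⟩
  have h1 : q⁻¹ * q ^ n = q ^ (n - 1) := by rw [zpow_sub_one₀ hq0.ne', mul_comm]
  have h2 : q * q ^ n = q ^ (n + 1) := by rw [zpow_add_one₀ hq0.ne', mul_comm]
  rw [qLaplacian, h1, h2] at h
  simp only [QSturm.gridSeq]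
  push_cast at h
  field_simp at h
  linear_combination h

lemma HasValuesAtZero.gridSeq {g : ℝ → ℂ} {A B : ℂ} (hg : HasValuesAtZero q g A B) :
    SeqValuesAtZero q (gridSeq q g) A B := by
  refine ⟨by simpa [QSturm.gridSeq] using hg.1, ?_⟩
  simpa [QSturm.gridSeq] using hg.2

/-- A point of the Weyl circle `C_b` gives a solution without energy flux at `b`. -/
lemma energyFlux_eq_zero_of_mem_weylCircle (hq0 : 0 < q) (hq1 : q < 1) {F G : ℝ → ℂ} {l : ℂ}
    {n : ℤ} (hl : l ∈ weylCircle q G F (q ^ n)) :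
    energyFlux q (weylSeq (gridSeq q F) (gridSeq q G) l) n = 0 := by
  obtain ⟨β, hβ⟩ := hl
  have h1 : q⁻¹ * q ^ n = q ^ (n - 1) := by rw [zpow_sub_one₀ hq0.ne', mul_comm]
  have h2 : q * q ^ (n - 1) = q ^ n := by
    rw [zpow_sub_one₀ hq0.ne']; field_simp
  simp only [shiftQDeriv, qDeriv, h1, h2] at hβ
  set X := weylSeq (gridSeq q F) (gridSeq q G) l n with hX
  set Y := weylSeq (gridSeq q F) (gridSeq q G) l (n - 1) with hY
  set d : ℝ := (1 - q) * q ^ (n - 1) with hd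
  have hd0 : 0 < d := mul_pos (sub_pos.2 hq1) (zpow_pos hq0 _)
  have hd' : (d : ℂ) ≠ 0 := by exact_mod_cast hd0.ne'
  have hβ' : X * ((d * Real.cos β - Real.sin β : ℝ) : ℂ) + Y * (Real.sin β : ℂ) = 0 := by
    have : X * (Real.cos β : ℂ) + (Y - X) / d * (Real.sin β : ℂ) = 0 := by
      rw [← hβ]
      simp only [hX, hY, weylSeq, gridSeq]
      ring
    field_simp at this
    push_cast at this ⊢
    linear_combination this
  have him : (X * starRingEnd ℂ Y).im = 0 := by
    by_cases hs : Real.sin β = 0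
    · have hc : Real.cos β ≠ 0 := fun hc => by
        have := Real.sin_sq_add_cos_sq β
        rw [hs, hc] at this
        norm_num at this
      have hX0 : X = 0 := by
        rw [hs] at hβ'
        have hc' : (Real.cos β : ℂ) ≠ 0 := by exact_mod_cast hc
        push_cast at hβ' hc'
        simpa [hd', hc'] using hβ'
      simp [hX0]
    · have hYX : Y = ((-(d * Real.cos β - Real.sin β) / Real.sin β : ℝ) : ℂ) * X := by
        have hs' : (Real.sin β : ℂ) ≠ 0 := by exact_mod_cast hs
        push_cast at hβ' hs' ⊢
        field_simp
        linear_combination hβ'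
      rw [hYX, map_mul, Complex.conj_ofReal, mul_left_comm, Complex.im_ofReal_mul, Complex.mul_conj,
        Complex.ofReal_im, mul_zero]
  rw [energyFlux, ← hX, ← hY, him, mul_zero]

lemma isWeylSystem_gridSeq (hq0 : 0 < q) (hq1 : q < 1) {u : ℝ → ℝ} {α : ℝ} {Φ Θ : ℂ → ℝ → ℂ}
    (hΦ : IsPhi q u α Φ) (hΘ : IsTheta q u α Θ) (hm : IsWeylFunction q Θ Φ m) :
    IsWeylSystem q (fun n => u (q ^ n)) (√q / (1 - q) * Real.sin α)
      (-(√q / (1 - q)) * Real.cos α) (√q / (1 - q) * Real.cos α) (√q / (1 - q) * Real.sin α)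
      (fun z => gridSeq q (Φ z)) (fun z => gridSeq q (Θ z)) m where
  φ_sol z := (hΦ z).1.gridSeq hq0
  θ_sol z := (hΘ z).1.gridSeq hq0
  φ_zero z := (hΦ z).2.gridSeq
  θ_zero z := (hΘ z).2.gridSeq
  normalised := by
    have h1 : (1 - q) ≠ 0 := (sub_pos.2 hq1).ne'
    have h2 := Real.sq_sqrt hq0.le
    have h3 := Real.sin_sq_add_cos_sq α
    field_simp
    rw [h2]
    linear_combination q * h3
  weyl z hz := by
    obtain ⟨l, hl, hlim⟩ := hm.isWeylLimit z hz
    exact ⟨l, fun N => energyFlux_eq_zero_of_mem_weylCircle hq0 hq1 (hl N), hlim⟩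
  analyticAt := hm.analyticAt
  meromorphicAt := hm.meromorphicAt

end Expansion

end QSturm

theorem theorem2 (q : ℝ) (hq0 : 0 < q) (hq1 : q < 1) (v : ℝ → ℝ) (α : ℝ)
    (φ θ : ℂ → ℝ → ℂ) (hφ : IsPhi q v α φ) (hθ : IsTheta q v α θ)
    (m : ℂ → ℂ) (hm : IsWeylFunction q θ φ m)
    {ι : Type*} (lam : ι → ℝ) (hlam_inj : Function.Injective lam)
    (hlam : Set.range (fun n => (lam n : ℂ)) = poles m)
    (f : ℝ → ℂ) (hf : MemClass q v α θ φ m f) :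
    (∀ n, QIntegrable q fun x => eigenfunction φ m (lam n) x * f x) ∧
      HasSum (fun n => qFourierCoeff q φ m f (lam n) ^ 2) (qIntegral q fun x => f x ^ 2) := by
  have hW := isWeylSystem_gridSeq hq0 hq1 hφ hθ hm
  have hfin := finite_setOf_norm_lt hm.meromorphicAt hlam_inj
    fun n => hlam ▸ Set.mem_range_self n
  have hU := hW.isRieszResolution hq0 hq1 hlam_inj hfin hlam
  have h1q : (0 : ℝ) < 1 - q := sub_pos.2 hq1
  have h1q' : (1 - q : ℂ) ≠ 0 := by exact_mod_cast h1q.ne'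
  have hw := fun j => weight_pos hq0 hq1 j
  -- the unitary map from the grid with Jackson's weight to `ℓ²(ℤ)`
  set x : ℤ → ℂ := fun j => (√(weight q j) : ℂ) * f (q ^ j) with hx
  have hx2 : Summable fun j => ‖x j‖ ^ 2 := by
    refine (hf.memL2.mul_left (1 - q)).congr fun j => ?_
    rw [hx, norm_mul, Complex.norm_real, mul_pow, Real.norm_eq_abs, sq_abs,
      Real.sq_sqrt (hw j).le, weight, mul_assoc]
  obtain ⟨hsumm, hpars⟩ := hU.hasSum_sq_complex hx2
  have hxx : ∀ j, x j ^ 2 = ((1 - q : ℝ) : ℂ) * (((q ^ j : ℝ) : ℂ) * f (q ^ j) ^ 2) := fun j => by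
    rw [hx, mul_pow, ← Complex.ofReal_pow, Real.sq_sqrt (hw j).le, weight]
    push_cast; ring
  have hterm : ∀ n j, ((1 - q : ℝ) : ℂ) * (((q ^ j : ℝ) : ℂ) *
      (eigenfunction φ m (lam n) (q ^ j) * f (q ^ j))) =
      (eigenvector q (fun z => gridSeq q (φ z)) m (lam n) j : ℂ) * x j := fun n j => by
    obtain ⟨r, hr0, hr⟩ := hW.exists_simplePoleResidue_eq hq0 hq1 (lam n)
    have hreal : (((gridSeq q (φ (lam n)) j).re : ℝ) : ℂ) = φ (lam n) (q ^ j) :=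
      hW.φ_real hq0 hq1 (lam n) j
    have hws : (√(weight q j) : ℂ) * (√(weight q j) : ℂ) =
        ((1 - q : ℝ) : ℂ) * ((q ^ j : ℝ) : ℂ) := by
      rw [← Complex.ofReal_mul, Real.mul_self_sqrt (hw j).le, weight, Complex.ofReal_mul]
    rw [eigenfunction, eigenvector, hr, Complex.sqrt_of_nonneg (by exact_mod_cast hr0),
      Complex.ofReal_re, Real.sqrt_mul hr0, Complex.ofReal_mul, hreal, hx, Complex.ofReal_mul]
    linear_combination -((√r : ℂ) * φ (lam n) (q ^ j) * f (q ^ j)) * hws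
  refine ⟨fun n => ?_, ?_⟩
  · refine ((hsumm n).mul_left (((1 - q : ℝ) : ℂ)⁻¹)).congr fun j => ?_
    rw [← hterm, inv_mul_cancel_left₀ (by exact_mod_cast h1q')]
  · have h2 : qIntegral q (fun x => f x ^ 2) = ∑' j, x j ^ 2 := by
      rw [qIntegral, ← tsum_mul_left]
      exact tsum_congr fun j => (hxx j).symm
    have h3 : ∀ n, qFourierCoeff q φ m f (lam n) =
        ∑' j, (eigenvector q (fun z => gridSeq q (φ z)) m (lam n) j : ℂ) * x j := fun n => by
      rw [qFourierCoeff, qIntegral, ← tsum_mul_left]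
      exact tsum_congr fun j => hterm n j
    simp only [h2, h3]
    exact hpars
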